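/- **Setting.** Let $(\Omega,\mathcal F,\mathbb P)$ be a probability space, $D\subset\mathbb R^3$ a bounded domain containing the origin, and $\sigma,V,f:\mathbb R^3\to\mathbb R$ measurable functions with $\sigma^2,V,f\in L^\infty(\mathbb R^3)$ and with supports that are compact subsets of $D$. Let $\dot B$ be a Gaussian white noise on $D$: for $\varphi,\psi\in L^2(D;\mathbb R)$ the random variable $\langle\dot B,\varphi\rangle$ is Gaussian with mean zero and variance $\|\varphi\|_{L^2(D)}^2$, and $\mathbb E(\langle\dot B,\varphi\rangle\langle\dot B,\psi\rangle)=\int_D\varphi\psi\,dx$; the pairing is extended to complex $\varphi$ by linearity. Let $\alpha\in\{0,1\}$ and $u^i(x)=e^{ikx\cdot d}$ with $d\in\mathbb S^2$. Put $$\Phi_k(x,y)=\frac{e^{ik|x-y|}}{4\pi|x-y|},\qquad \mathcal R_k\varphi(x)=\int\Phi_k(x,y)\varphi(y)\,dy,\qquad \mathcal R_k(\sigma\dot B)(x)=\langle\dot B,\sigma\,\Phi_k(x,\cdot)\rangle .$$ For $s\in\mathbb R$ let $\|\varphi\|_{L^2_s}=\|(1+|\cdot|^2)^{s/2}\varphi\|_{L^2(\mathbb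 R^3)}$. Fix $\epsilon>0$ and let $$k^*=\max\Big\{k_0,\ \sup\{k>0:\ \|\mathcal R_kV\|_{L^2_{-1/2-\epsilon}\to L^2_{-1/2-\epsilon}}\ge 1\}+1\Big\},$$ where $k_0$ is the infimum of all $\kappa\ge2$ for which there is a constant $C$ with $\|\mathcal R_k\varphi\|_{L^2_{-1/2-\epsilon}}\le Ck^{-1}\|\varphi\|_{L^2_{1/2+\epsilon}}$ for all $k>\kappa$ and all $\varphi\in L^2_{1/2+\epsilon}$ (Agmon's estimate). Here $\inf\emptyset=\infty$ and $\sup\emptyset=0$. **Far-field pattern.** The far-field pattern of the mild solution of $$(-\Delta-k^2+V)u=f+\sigma\dot B,\qquad u=\alpha u^i+u^{sc},\qquad u^{sc}\text{ outgoing},$$ is $$u^\infty(\hat x,k,d,\omega)=\frac1{4\pi}\int_D e^{-ik\hat x\cdot y}\,(I-V\mathcal R_k)^{-1}(\alpha Vu^i-f-\sigma\dot B_y)\,dy,\qquad \hat x\in\mathbb S^2 .$$ Here $(I-V\mathcal R_k)^{-1}(\alpha Vu^i-f-\sigma\dot B)$ means $g-\sigma\dot B$, where $g=g(\cdot,d,\omega)\in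 L^2(D)$ is the solution of $(I-V\mathcal R_k)g=\alpha Vu^i-f-V\mathcal R_k(\sigma\dot B)$ in $L^2(D)$. Thus $$u^\infty(\hat x,k,d,\omega)=\frac1{4\pi}\Big(\int_De^{-ik\hat x\cdot y}g(y,d,\omega)\,dy-\langle\dot B,e^{-ik\hat x\cdot(\cdot)}\sigma\rangle\Big),$$ where the random fields $\mathcal R_k(\sigma\dot B)(x)$, $x\in\mathbb R^3$, and $\langle\dot B,e^{-ik\hat x\cdot(\cdot)}\sigma\rangle$, $\hat x\in\mathbb S^2$, are represented by jointly measurable versions (for every value of the parameter, equal to the given random variable almost surely). **Theorem.** Let $k>k^*$. Then the far-field pattern is well defined: 1. $I-V\mathcal R_k$ has a bounded inverse on $L^2(D)$, the two random fields above have jointly measurable versions, and for all $\hat x,d\in\mathbb S^2$ other choices of the versions change $u^\infty(\hat x,k,d,\cdot)$ only on a null set. 2. For any choice of the versions and every $d\in\mathbb S^2$, $u^\infty(\cdot,k,d,\cdot)$ is measurable on $\mathbb S^2\times\Omega$ (for the completed product measure), and $$\mathbb E\int_{\mathbb S^2}|u^\infty(\hat x,k,d,\omega)|^2\,dS(\hat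 x)<\infty .$$ 3. For any choice of the versions there is $\Omega_0\subset\Omega$ with $\mathbb P(\Omega_0)=0$ such that for all $\omega\in\Omega\setminus\Omega_0$ and all $d\in\mathbb S^2$ the function $g(\cdot,d,\omega)\in L^2(D)$ exists and $u^\infty(\cdot,k,d,\omega)\in L^2(\mathbb S^2)$. -/

import Mathlib

open MeasureTheory ProbabilityTheory
open scoped ENNReal NNReal

namespace RandomSchrodinger

noncomputable section

/-- Euclidean three-space. -/
abbrev E3 : Type := EuclideanSpace ℝ (Fin 3)

/-- The unit sphere of three-space. -/
abbrev S2 : Type := Metric.sphere (0 : E3) 1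

/-- The surface measure on the unit sphere. -/
abbrev surf : Measure S2 := (volume : Measure E3).toSphere

/-- The outgoing fundamental solution of `-Δ - k²` centered at `y`. -/
def Phi (k : ℝ) (x y : E3) : ℂ :=
  Complex.exp (Complex.I * ((k * ‖x - y‖ : ℝ) : ℂ)) / ((4 * Real.pi * ‖x - y‖ : ℝ) : ℂ)

/-- The resolvent operator `(R_k φ)(x) = ∫ Φ_k(x,y) φ(y) dy`. -/
def Rk (k : ℝ) (φ : E3 → ℂ) (x : E3) : ℂ := ∫ y, Phi k x y * φ y

/-- Multiplication by the weight `⟨x⟩ ^ s`, where `⟨x⟩ = (1 + |x|²)^(1/2)`. -/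
def weighted (s : ℝ) (φ : E3 → ℂ) (x : E3) : ℂ :=
  ((Real.sqrt (1 + ‖x‖ ^ 2) ^ s : ℝ) : ℂ) * φ x

/-- The norm of the weighted space `L²_s(ℝ³)`, with value `∞` off the space. -/
def wnorm (s : ℝ) (φ : E3 → ℂ) : ℝ≥0∞ := eLpNorm (weighted s φ) 2 volume

/-- Membership in the weighted space `L²_s(ℝ³)`. -/
def MemL2w (s : ℝ) (φ : E3 → ℂ) : Prop := MemLp (weighted s φ) 2 volume

/-- The threshold `k₀` of Agmon's estimate: the infimum of all `κ ≥ 2` for which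
`‖R_k φ‖_{L²_{-1/2-ε}} ≤ C k⁻¹ ‖φ‖_{L²_{1/2+ε}}` holds for all `k > κ` and all `φ`, with a
constant `C` independent of `k` and `φ`. -/
def agmonThreshold (ε : ℝ) : ℝ≥0∞ :=
  sInf {κ : ℝ≥0∞ | 2 ≤ κ ∧ ∃ C : ℝ≥0, ∀ k : ℝ, 0 < k → κ < ENNReal.ofReal k →
    ∀ φ : E3 → ℂ, MemL2w (1 / 2 + ε) φ →
      wnorm (-1 / 2 - ε) (Rk k φ) ≤ C * ENNReal.ofReal k⁻¹ * wnorm (1 / 2 + ε) φ}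

/-- The operator norm of `φ ↦ R_k (V φ)` on `L²_s(ℝ³)`, i.e. the least bound. -/
def opNormRV (s k : ℝ) (V : E3 → ℝ) : ℝ≥0∞ :=
  sInf {C : ℝ≥0∞ | ∀ φ : E3 → ℂ, MemL2w s φ →
    wnorm s (Rk k fun y => (V y : ℂ) * φ y) ≤ C * wnorm s φ}

/-- The wave number threshold
`k* = max (k₀, sup {k > 0 : ‖R_k V‖_{L(L²_{-1/2-ε}, L²_{-1/2-ε})} ≥ 1} + 1)`. -/
def kStar (ε : ℝ) (V : E3 → ℝ) : ℝ≥0∞ :=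
  max (agmonThreshold ε)
    ((⨆ k ∈ {k : ℝ | 0 < k ∧ 1 ≤ opNormRV (-1 / 2 - ε) k V}, ENNReal.ofReal k) + 1)

/-- The (essential) support of `g` is a compact subset of `D`. -/
def CompactlySupportedIn (g : E3 → ℝ) (D : Set E3) : Prop :=
  ∃ K : Set E3, IsCompact K ∧ K ⊆ D ∧ ∀ᵐ x, x ∉ K → g x = 0

/-- `B` is a Gaussian white noise on `D`, extended to square integrable functions: for
`φ, ψ ∈ L²(D; ℝ)` the random variable `⟨B, φ⟩` is centered Gaussian with variance
`∫_D φ²`, and the covariance of `⟨B, φ⟩` and `⟨B, ψ⟩` is `∫_D φ ψ`. (Almost sure linearity in `φ`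
and joint Gaussianity follow. The values of `B` off `L²(D; ℝ)` are irrelevant.) -/
structure IsWhiteNoise {Ω : Type*} [MeasurableSpace Ω] (P : Measure Ω) (D : Set E3)
    (B : (E3 → ℝ) → Ω → ℝ) : Prop where
  gaussian : ∀ φ : E3 → ℝ, MemLp φ 2 (volume.restrict D) →
    HasLaw (B φ) (gaussianReal 0 (∫ x in D, φ x ^ 2).toNNReal) P
  covariance : ∀ φ ψ : E3 → ℝ, MemLp φ 2 (volume.restrict D) → MemLp ψ 2 (volume.restrict D) →
    ∫ ω, B φ ω * B ψ ω ∂P = ∫ x in D, φ x * ψ x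

/-- The complex linear extension of the pairing with white noise. -/
def pairing {Ω : Type*} (B : (E3 → ℝ) → Ω → ℝ) (φ : E3 → ℂ) (ω : Ω) : ℂ :=
  (B (fun y => (φ y).re) ω : ℂ) + Complex.I * (B (fun y => (φ y).im) ω : ℂ)

/-- The random field `R_k(σ B)(x) = ⟨B, σ Φ_k(x, ·)⟩`. -/
def RkNoise {Ω : Type*} (B : (E3 → ℝ) → Ω → ℝ) (σ : E3 → ℝ) (k : ℝ) (x : E3) (ω : Ω) : ℂ :=
  pairing B (fun y => (σ y : ℂ) * Phi k x y) ω

/-- The plane wave `e^{-i k x̂·y}`. -/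
def planeWave (k : ℝ) (xhat : S2) (y : E3) : ℂ :=
  Complex.exp (-Complex.I * ((k * inner ℝ (xhat : E3) y : ℝ) : ℂ))

/-- The incident plane wave `u^i(y) = e^{i k y·d}`. -/
def incident (k : ℝ) (d : S2) (y : E3) : ℂ :=
  Complex.exp (Complex.I * ((k * inner ℝ y (d : E3) : ℝ) : ℂ))

/-- The random field `∫_D e^{-i k x̂·y} σ(y) dB_y = ⟨B, e^{-i k x̂·(·)} σ⟩` on the sphere. -/
def sphereNoise {Ω : Type*} (B : (E3 → ℝ) → Ω → ℝ) (σ : E3 → ℝ) (k : ℝ) (xhat : S2) (ω : Ω) : ℂ :=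
  pairing B (fun y => planeWave k xhat y * (σ y : ℂ)) ω

/-- `Y` is a measurable version of the random field `X`: it is jointly measurable in the parameter
and the sample, and `Y t = X t` almost surely for every `t`. A pairing of white noise with an
`L²` function is only determined almost surely, so that a random field built from such pairings
has to be read through a measurable version. -/
def IsMeasurableVersion {T Ω : Type*} [MeasurableSpace T] [MeasurableSpace Ω] (P : Measure Ω)
    (X Y : T → Ω → ℂ) : Prop :=
  Measurable (fun p : T × Ω => Y p.1 p.2) ∧ ∀ t, Y t =ᵐ[P] X t

/-- `g ∈ L²(D)` solves `(I - V R_k) g = h` in `L²(D)`. -/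
def IsSol (D : Set E3) (k : ℝ) (V : E3 → ℝ) (h g : E3 → ℂ) : Prop :=
  MemLp g 2 (volume.restrict D) ∧
    ∀ᵐ y ∂(volume.restrict D), g y - (V y : ℂ) * Rk k (D.indicator g) y = h y

/-- `I - V R_k` is bijective on `L²(D)`, with a bounded inverse. -/
def HasBoundedInverse (D : Set E3) (k : ℝ) (V : E3 → ℝ) : Prop :=
  ∃ C : ℝ≥0, ∀ h : E3 → ℂ, MemLp h 2 (volume.restrict D) →
    (∃ g, IsSol D k V h g) ∧
    (∀ g g', IsSol D k V h g → IsSol D k V h g' → g =ᵐ[volume.restrict D] g') ∧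
    ∀ g, IsSol D k V h g →
      eLpNorm g 2 (volume.restrict D) ≤ C * eLpNorm h 2 (volume.restrict D)

open scoped Classical in
/-- `(I - V R_k)⁻¹ h`, as a function representing the solution in `L²(D)` (zero if none). -/
def invIVR (D : Set E3) (k : ℝ) (V : E3 → ℝ) (h : E3 → ℂ) : E3 → ℂ :=
  if H : ∃ g, IsSol D k V h g then H.choose else 0

/-- The function `α V u^i - f - V W`, where `W` is a realization of `R_k(σ B)`. -/
def source (k : ℝ) (V f : E3 → ℝ) (α : ℝ) (d : S2) (W : E3 → ℂ) (y : E3) : ℂ :=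
  (α : ℂ) * (V y : ℂ) * incident k d y - (f y : ℂ) - (V y : ℂ) * W y

/-- The far-field pattern
`u^∞(x̂,k,d,ω) = (4π)⁻¹ ∫_D e^{-i k x̂·y} (I - V R_k)⁻¹ (α V u^i - f - σ B) dy`.
Here `W` and `Z` are versions of the random fields `R_k(σ B)` on `ℝ³` and
`∫_D e^{-i k x̂·y} σ(y) dB_y` on the sphere. The source `α V u^i - f - σ B` is a
distribution, and its image under `(I - V R_k)⁻¹` is `g - σ B`, where `g ∈ L²(D)` is determined by
`(I - V R_k) g = α V u^i - f - V R_k(σ B)`: this is the one element `G` of `-σ B + L²(D)` with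
`(I - V R_k) G = α V u^i - f - σ B`, and the sum of the Neumann series of `V R_k` when that
series converges. -/
def farField {Ω : Type*} (D : Set E3) (k : ℝ) (V f : E3 → ℝ) (α : ℝ)
    (W : E3 → Ω → ℂ) (Z : S2 → Ω → ℂ) (xhat d : S2) (ω : Ω) : ℂ :=
  1 / (4 * Real.pi) *
    ((∫ y in D, planeWave k xhat y * invIVR D k V (source k V f α d fun x => W x ω) y)
      - Z xhat ω)

end

end RandomSchrodinger

open RandomSchrodinger

/-! The deterministic core is a factorization. Put `s = -1/2 - ε`. On L²(D) the operator V R_k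
equals T R, where R h = ⟨x⟩^s R_k(1_D h) maps L²(D) to L²(ℝ³) and T w = V ⟨x⟩^{-s} w maps back.
Agmon's estimate bounds R; boundedness of V and D bounds T. Nothing makes T R a contraction on
L²(D), but R T is R_k V conjugated by the weight, so its norm is below 1 above the threshold. A
Neumann series inverts 1 - R T, and 1 + T (1 - R T)⁻¹ R then inverts 1 - T R
(`exists_inverse_one_sub_comp`, `exists_solution_clm`).

On the random side, the pairing preserves L² distances from L²(D) to L²(Ω). Approximation from a
countable dense set therefore yields jointly measurable versions (`exists_measurableVersion`). The
fields have uniformly bounded second moments because |x - y|⁻² is locally integrable in dimension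
three (`exists_lintegral_Phi_le`). By Tonelli, almost every realization is square integrable on D
and on the sphere; the source then lies in L²(D) for all directions d at once, and the far field is
controlled by these two L² norms.

Joint measurability needs care, since solutions are picked by choice separately for each ω. The
adjoint of the solution operator turns each far-field coefficient into an integral against the
source, in which no choice remains (`integral_planeWave_mul_clm`); continuity in the observation
direction does the rest. -/

namespace RandomSchrodinger

open Filter Topology

/-! ### Square integrability and operators on L² spaces -/

section Preliminaries

variable {X Y : Type*} [MeasurableSpace X] [MeasurableSpace Y]

lemma eLpNorm_two_sq {E : Type*} [NormedAddCommGroup E] (f : X → E) (μ : Measure X) :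
    eLpNorm f 2 μ ^ 2 = ∫⁻ x, ‖f x‖ₑ ^ 2 ∂μ := by
  have h := eLpNorm_nnreal_pow_eq_lintegral (μ := μ) (f := f) (p := 2) two_ne_zero
  simp only [NNReal.coe_ofNat, ENNReal.rpow_ofNat, ENNReal.coe_ofNat] at h
  exact h

lemma memLp_two_iff_lintegral {E : Type*} [NormedAddCommGroup E] {f : X → E} {μ : Measure X} :
    MemLp f 2 μ ↔ AEStronglyMeasurable f μ ∧ ∫⁻ x, ‖f x‖ₑ ^ 2 ∂μ < ∞ := by
  rw [← eLpNorm_two_sq, MemLp]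
  simp [ENNReal.pow_lt_top_iff]

lemma enorm_sub_sq_le {E : Type*} [NormedAddCommGroup E] (a b : E) :
    ‖a - b‖ₑ ^ 2 ≤ 2 * (‖a‖ₑ ^ 2 + ‖b‖ₑ ^ 2) := by
  have h : ‖a - b‖ ^ 2 ≤ 2 * (‖a‖ ^ 2 + ‖b‖ ^ 2) := by
    have := norm_sub_le a b
    nlinarith [sq_nonneg (‖a‖ - ‖b‖), norm_nonneg (a - b), norm_nonneg a, norm_nonneg b]
  simp only [← ofReal_norm]
  rw [← ENNReal.ofReal_pow (norm_nonneg _), ← ENNReal.ofReal_pow (norm_nonneg _),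
    ← ENNReal.ofReal_pow (norm_nonneg _), ← ENNReal.ofReal_add (by positivity) (by positivity),
    ← ENNReal.ofReal_ofNat 2, ← ENNReal.ofReal_mul (by norm_num)]
  exact ENNReal.ofReal_le_ofReal h

/-- A map on functions that is linear and bounded in the `L²` norms up to null sets induces a
bounded operator between the `L²` spaces. -/
lemma exists_clm_of_bound (μ : Measure X) (ν : Measure Y) (K : (X → ℂ) → Y → ℂ) (C : ℝ≥0)
    (hmeas : ∀ f, MemLp f 2 μ → AEStronglyMeasurable (K f) ν)
    (hcongr : ∀ f g, f =ᵐ[μ] g → K f =ᵐ[ν] K g)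
    (hadd : ∀ f g, MemLp f 2 μ → MemLp g 2 μ → K (f + g) =ᵐ[ν] K f + K g)
    (hsmul : ∀ (c : ℂ) f, MemLp f 2 μ → K (c • f) =ᵐ[ν] c • K f)
    (hbd : ∀ f, MemLp f 2 μ → eLpNorm (K f) 2 ν ≤ C * eLpNorm f 2 μ) :
    ∃ T : Lp ℂ 2 μ →L[ℂ] Lp ℂ 2 ν, ‖T‖ ≤ C ∧
      (∀ f : Lp ℂ 2 μ, T f =ᵐ[ν] K f) ∧
      ∀ f (hf : MemLp f 2 μ), T (hf.toLp f) =ᵐ[ν] K f := by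
  have hmem : ∀ f : Lp ℂ 2 μ, MemLp (K f) 2 ν := fun f =>
    ⟨hmeas _ (Lp.memLp f), (hbd _ (Lp.memLp f)).trans_lt
      (ENNReal.mul_lt_top ENNReal.coe_lt_top (Lp.memLp f).2)⟩
  let L : Lp ℂ 2 μ →ₗ[ℂ] Lp ℂ 2 ν :=
    { toFun := fun f => (hmem f).toLp _
      map_add' := fun f g => by
        rw [← MemLp.toLp_add, MemLp.toLp_eq_toLp_iff]
        exact (hcongr _ _ (Lp.coeFn_add f g)).trans (hadd _ _ (Lp.memLp f) (Lp.memLp g))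
      map_smul' := fun c f => by
        rw [RingHom.id_apply, ← MemLp.toLp_const_smul, MemLp.toLp_eq_toLp_iff]
        exact (hcongr _ _ (Lp.coeFn_smul c f)).trans (hsmul c _ (Lp.memLp f)) }
  have hL : ∀ f, L f =ᵐ[ν] K f := fun f => MemLp.coeFn_toLp (hmem f)
  refine ⟨L.mkContinuous C fun f => ?_, L.mkContinuous_norm_le C.2 _, hL, fun f hf => ?_⟩
  · change ‖(hmem f).toLp _‖ ≤ _
    rw [Lp.norm_toLp, Lp.norm_def]
    have := ENNReal.toReal_mono
      (ENNReal.mul_ne_top ENNReal.coe_ne_top (Lp.memLp f).2.ne) (hbd _ (Lp.memLp f))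
    rwa [ENNReal.toReal_mul, ENNReal.coe_toReal] at this
  · exact (hL _).trans (hcongr _ _ hf.coeFn_toLp)

end Preliminaries

/-! ### The fundamental solution and the resolvent on bounded domains -/

section Kernel

lemma measurable_Phi (k : ℝ) : Measurable (fun p : E3 × E3 => Phi k p.1 p.2) := by
  unfold Phi
  fun_prop

lemma norm_Phi_le (k : ℝ) (x y : E3) : ‖Phi k x y‖ ≤ ‖y - x‖⁻¹ := by
  unfold Phi
  rw [norm_div, mul_comm Complex.I, Complex.norm_exp_ofReal_mul_I, Complex.norm_real,
    Real.norm_of_nonneg (by positivity), one_div, norm_sub_rev x y, mul_inv]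
  refine mul_le_of_le_one_left (by positivity) (inv_le_one_of_one_le₀ ?_)
  nlinarith [Real.pi_gt_three]

/-- In polar coordinates the factor r² of the volume element cancels r⁻², leaving the constant 1 on
(0, 1). -/
lemma lintegral_ball_inv_sq_lt_top :
    ∫⁻ z in Metric.ball (0 : E3) 1, ‖‖z‖⁻¹‖ₑ ^ 2 < ∞ := by
  have h : IntegrableOn (fun z : E3 => (‖z‖⁻¹) ^ 2) (Metric.ball (0 : E3) 1) := by
    rw [integrableOn_fun_norm_addHaar (μ := (volume : Measure E3)) (f := fun r => (r⁻¹) ^ 2)]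
    have : IntegrableOn (fun _ : ℝ => (1 : ℝ)) (Set.Ioo 0 1) := by simp
    refine this.congr_fun (fun y hy => ?_) measurableSet_Ioo
    have : y ≠ 0 := hy.1.ne'
    simp [this]
  have h2 := h.2
  unfold HasFiniteIntegral at h2
  simpa only [enorm_pow] using h2

/-- The square of the fundamental solution has a uniformly bounded integral over a bounded
domain. -/
lemma exists_lintegral_Phi_le (k : ℝ) {D : Set E3} (hD : Bornology.IsBounded D) :
    ∃ M : ℝ≥0, ∀ x, ∫⁻ y in D, ‖Phi k x y‖ₑ ^ 2 ≤ M := by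
  have hfin : (∫⁻ z in Metric.ball (0 : E3) 1, ‖‖z‖⁻¹‖ₑ ^ 2) + volume D < ∞ :=
    ENNReal.add_lt_top.2 ⟨lintegral_ball_inv_sq_lt_top, hD.measure_lt_top⟩
  refine ⟨((∫⁻ z in Metric.ball (0 : E3) 1, ‖‖z‖⁻¹‖ₑ ^ 2) + volume D).toNNReal, fun x => ?_⟩
  rw [ENNReal.coe_toNNReal hfin.ne]
  -- The singular part is cut off at distance 1, where it is integrable with a translation-invariant
  -- integral; beyond that distance the kernel is at most 1 and contributes at most the volume of D.
  let F : E3 → ℝ≥0∞ := (Metric.ball (0 : E3) 1).indicator fun z => ‖‖z‖⁻¹‖ₑ ^ 2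
  have hF : Measurable F := by
    refine Measurable.indicator ?_ measurableSet_ball
    fun_prop
  have hpt : ∀ y, ‖Phi k x y‖ₑ ^ 2 ≤ F (y - x) + 1 := fun y => by
    have h1 : ‖Phi k x y‖ₑ ≤ ‖‖y - x‖⁻¹‖ₑ := by
      rw [enorm_le_iff_norm_le]
      simpa using norm_Phi_le k x y
    by_cases hy : y - x ∈ Metric.ball (0 : E3) 1
    · have : F (y - x) = ‖‖y - x‖⁻¹‖ₑ ^ 2 := Set.indicator_of_mem hy _
      rw [this]
      exact (pow_le_pow_left' h1 2).trans le_self_add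
    · have h2 : ‖‖y - x‖⁻¹‖ₑ ≤ 1 := by
        rw [← enorm_one (G := ℝ), enorm_le_iff_norm_le]
        simp only [Metric.mem_ball, dist_zero_right, not_lt] at hy
        simpa using inv_le_one_of_one_le₀ hy
      calc _ ≤ (1 : ℝ≥0∞) ^ 2 := pow_le_pow_left' (h1.trans h2) 2
        _ ≤ _ := by simp
  calc ∫⁻ y in D, ‖Phi k x y‖ₑ ^ 2 ≤ ∫⁻ y in D, (F (y - x) + 1) := lintegral_mono hpt
    _ = (∫⁻ y in D, F (y - x)) + volume D := by
      rw [lintegral_add_right _ measurable_const]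
      simp
    _ ≤ (∫⁻ y, F (y - x)) + volume D := by gcongr; exact Measure.restrict_le_self
    _ = _ := by
      rw [lintegral_sub_right_eq_self F x, lintegral_indicator measurableSet_ball]

lemma memLp_Phi (k : ℝ) {D : Set E3} (hD : Bornology.IsBounded D) (x : E3) :
    MemLp (Phi k x) 2 (volume.restrict D) := by
  obtain ⟨M, hM⟩ := exists_lintegral_Phi_le k hD
  exact memLp_two_iff_lintegral.2 ⟨((measurable_Phi k).comp
    measurable_prodMk_left).aestronglyMeasurable, (hM x).trans_lt ENNReal.coe_lt_top⟩

variable {D : Set E3}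

lemma integrable_Phi_mul (k : ℝ) (hDm : MeasurableSet D) (hD : Bornology.IsBounded D)
    {φ : E3 → ℂ} (hφ : MemLp φ 2 (volume.restrict D)) (x : E3) :
    Integrable (fun y => Phi k x y * D.indicator φ y) := by
  have h : (fun y => Phi k x y * D.indicator φ y) = D.indicator (fun y => Phi k x y * φ y) := by
    ext y
    by_cases hy : y ∈ D <;> simp [hy]
  rw [h, integrable_indicator_iff hDm]
  exact (memLp_Phi k hD x).integrable_mul hφ

lemma Rk_congr (k : ℝ) {φ ψ : E3 → ℂ} (h : φ =ᵐ[volume] ψ) : Rk k φ = Rk k ψ := by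
  ext x
  exact integral_congr_ae (h.mono fun y hy => by simp only [hy])

lemma indicator_congr_ae (hDm : MeasurableSet D) {φ ψ : E3 → ℂ}
    (h : φ =ᵐ[volume.restrict D] ψ) : D.indicator φ =ᵐ[volume] D.indicator ψ :=
  by
  have := (ae_restrict_iff' hDm).1 h
  filter_upwards [this] with y hy
  by_cases hyD : y ∈ D <;> simp [hyD, hy]

lemma Rk_indicator_add (k : ℝ) (hDm : MeasurableSet D) (hD : Bornology.IsBounded D)
    {φ ψ : E3 → ℂ} (hφ : MemLp φ 2 (volume.restrict D)) (hψ : MemLp ψ 2 (volume.restrict D)) :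
    Rk k (D.indicator (φ + ψ)) = Rk k (D.indicator φ) + Rk k (D.indicator ψ) := by
  ext x
  simp only [Rk, Pi.add_apply, Set.indicator_add', mul_add]
  exact integral_add (integrable_Phi_mul k hDm hD hφ x) (integrable_Phi_mul k hDm hD hψ x)

lemma Rk_indicator_smul (k : ℝ) (c : ℂ) (φ : E3 → ℂ) :
    Rk k (D.indicator (c • φ)) = c • Rk k (D.indicator φ) := by
  ext x
  simp only [Rk, Pi.smul_apply, smul_eq_mul, ← integral_const_mul]
  congr 1 with y
  by_cases hy : y ∈ D <;> simp [hy, mul_left_comm]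

lemma aestronglyMeasurable_Rk (k : ℝ) {φ : E3 → ℂ} (hφ : AEStronglyMeasurable φ volume) :
    AEStronglyMeasurable (Rk k φ) volume := by
  refine AEStronglyMeasurable.integral_prod_right' (f := fun p : E3 × E3 => Phi k p.1 p.2 * φ p.2)
    ?_
  exact (measurable_Phi k).aestronglyMeasurable.mul hφ.comp_snd

end Kernel

/-! ### Polynomial weights, bounded above on bounded sets for every exponent -/

section Weights

lemma sqrt_one_add_norm_sq_pos (x : E3) : 0 < Real.sqrt (1 + ‖x‖ ^ 2) :=
  Real.sqrt_pos.2 (by positivity)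

lemma continuous_weight (s : ℝ) : Continuous fun x : E3 => Real.sqrt (1 + ‖x‖ ^ 2) ^ s :=
  Continuous.rpow_const (by fun_prop) fun x => Or.inl (sqrt_one_add_norm_sq_pos x).ne'

lemma exists_weight_le (s : ℝ) {D : Set E3} (hD : Bornology.IsBounded D) :
    ∃ c : ℝ≥0, ∀ x ∈ D, Real.sqrt (1 + ‖x‖ ^ 2) ^ s ≤ c := by
  obtain ⟨c, hc⟩ := (hD.isCompact_closure.image (continuous_weight s)).isBounded.bddAbove
  exact ⟨c.toNNReal, fun x hx =>
    (hc (Set.mem_image_of_mem _ (subset_closure hx))).trans (Real.le_coe_toNNReal c)⟩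

lemma weighted_weighted (s t : ℝ) (φ : E3 → ℂ) :
    weighted s (weighted t φ) = weighted (s + t) φ := by
  ext x
  simp only [weighted, Real.rpow_add (sqrt_one_add_norm_sq_pos x)]
  push_cast
  ring

lemma weighted_zero (φ : E3 → ℂ) : weighted 0 φ = φ := by
  ext x
  simp [weighted]

lemma weighted_add (s : ℝ) (φ ψ : E3 → ℂ) :
    weighted s (φ + ψ) = weighted s φ + weighted s ψ := by
  ext x
  simp [weighted, mul_add]

lemma weighted_smul (s : ℝ) (c : ℂ) (φ : E3 → ℂ) :
    weighted s (c • φ) = c • weighted s φ := by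
  ext x
  simp [weighted, mul_left_comm]

lemma weighted_congr {μ : Measure E3} (s : ℝ) {φ ψ : E3 → ℂ} (h : φ =ᵐ[μ] ψ) :
    weighted s φ =ᵐ[μ] weighted s ψ := h.mono fun x hx => by simp only [weighted, hx]

lemma aestronglyMeasurable_weighted {μ : Measure E3} (s : ℝ) {φ : E3 → ℂ}
    (hφ : AEStronglyMeasurable φ μ) : AEStronglyMeasurable (weighted s φ) μ :=
  (Complex.continuous_ofReal.comp (continuous_weight s)).aestronglyMeasurable.mul hφ

lemma norm_weighted (s : ℝ) (φ : E3 → ℂ) (x : E3) :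
    ‖weighted s φ x‖ = Real.sqrt (1 + ‖x‖ ^ 2) ^ s * ‖φ x‖ := by
  rw [weighted, norm_mul, Complex.norm_real, Real.norm_of_nonneg (by positivity)]

lemma exists_eLpNorm_weighted_le (s : ℝ) {D : Set E3} (hDm : MeasurableSet D)
    (hD : Bornology.IsBounded D) :
    ∃ c : ℝ≥0, ∀ φ : E3 → ℂ, eLpNorm (weighted s φ) 2 (volume.restrict D) ≤
      c * eLpNorm φ 2 (volume.restrict D) := by
  obtain ⟨c, hc⟩ := exists_weight_le s hD
  refine ⟨c, fun φ => eLpNorm_le_nnreal_smul_eLpNorm_of_ae_le_mul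
    (ae_restrict_of_forall_mem hDm fun x hx => ?_) 2⟩
  rw [← NNReal.coe_le_coe, NNReal.coe_mul, coe_nnnorm, coe_nnnorm, norm_weighted]
  exact mul_le_mul_of_nonneg_right (hc x hx) (norm_nonneg _)

lemma weighted_indicator (s : ℝ) (D : Set E3) (φ : E3 → ℂ) :
    weighted s (D.indicator φ) = D.indicator (weighted s φ) := by
  ext x
  by_cases hx : x ∈ D <;> simp [weighted, hx]

end Weights

/-! ### What exceeding the threshold k* provides -/

section Threshold

variable {ε k : ℝ} {V : E3 → ℝ}

lemma agmon_of_kStar_lt (hk : kStar ε V < ENNReal.ofReal k) :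
    ∃ C : ℝ≥0, ∀ φ : E3 → ℂ, MemL2w (1 / 2 + ε) φ →
      wnorm (-1 / 2 - ε) (Rk k φ) ≤ C * wnorm (1 / 2 + ε) φ := by
  obtain ⟨κ, ⟨-, C, hC⟩, hκk⟩ := sInf_lt_iff.1 ((le_max_left _ _).trans_lt hk)
  have hk0 : 0 < k := ENNReal.ofReal_pos.1 (bot_le.trans_lt hk)
  refine ⟨C * k⁻¹.toNNReal, fun φ hφ => ?_⟩
  rw [ENNReal.coe_mul]
  exact hC k hk0 hκk φ hφ

/-- Since k exceeds the supremum of the exceptional wave numbers, it is not exceptional itself. The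
norm is an infimum of admissible bounds, so being below 1 it leaves room for an admissible `C < 1`.
-/
lemma exists_lt_one_of_kStar_lt (hk : kStar ε V < ENNReal.ofReal k) :
    ∃ C : ℝ≥0, C < 1 ∧ ∀ φ : E3 → ℂ, MemL2w (-1 / 2 - ε) φ →
      wnorm (-1 / 2 - ε) (Rk k fun y => (V y : ℂ) * φ y) ≤ C * wnorm (-1 / 2 - ε) φ := by
  have hk0 : 0 < k := ENNReal.ofReal_pos.1 (bot_le.trans_lt hk)
  have hlt : opNormRV (-1 / 2 - ε) k V < 1 := by
    by_contra! h
    have h1 : ENNReal.ofReal k ≤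
        ⨆ k ∈ {k : ℝ | 0 < k ∧ 1 ≤ opNormRV (-1 / 2 - ε) k V}, ENNReal.ofReal k :=
      le_iSup₂ (f := fun (k : ℝ) (_ : k ∈ {k : ℝ | 0 < k ∧ 1 ≤ opNormRV (-1 / 2 - ε) k V}) =>
        ENNReal.ofReal k) k ⟨hk0, h⟩
    exact absurd ((h1.trans le_self_add).trans (le_max_right _ _)) (not_le.2 hk)
  obtain ⟨C, hC, hC1⟩ := sInf_lt_iff.1 hlt
  lift C to ℝ≥0 using (hC1.trans ENNReal.one_lt_top).ne
  exact ⟨C, by exact_mod_cast hC1, hC⟩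

end Threshold

/-! ### Inverting I - V R_k on L²(D) -/

section Resolvent

variable {D : Set E3} {k : ℝ} {V : E3 → ℝ}

lemma CompactlySupportedIn.ae_eq_zero {g : E3 → ℝ} (hg : CompactlySupportedIn g D) :
    ∀ᵐ x, x ∉ D → g x = 0 := by
  obtain ⟨K, -, hKD, h⟩ := hg
  exact h.mono fun x hx hxD => hx fun hxK => hxD (hKD hxK)

lemma exists_ae_bound {g : E3 → ℝ} (hg : MemLp g ∞ volume) :
    ∃ N : ℝ≥0, ∀ᵐ x, ‖(g x : ℂ)‖ ≤ N := by
  have hfin : eLpNormEssSup g volume < ∞ := by simpa using hg.2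
  refine ⟨(eLpNormEssSup g volume).toNNReal, (enorm_ae_le_eLpNormEssSup g volume).mono
    fun x hx => ?_⟩
  rw [Complex.norm_real, ← toReal_enorm]
  exact ENNReal.toReal_mono hfin.ne hx

lemma aestronglyMeasurable_ofReal_mul {μ : Measure E3} {g : E3 → ℝ} {φ : E3 → ℂ}
    (hg : AEStronglyMeasurable g μ) (hφ : AEStronglyMeasurable φ μ) :
    AEStronglyMeasurable (fun x => (g x : ℂ) * φ x) μ :=
  (Complex.continuous_ofReal.comp_aestronglyMeasurable hg).mul hφ

lemma eLpNorm_ofReal_mul_le {μ : Measure E3} {g : E3 → ℝ} {N : ℝ≥0}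
    (hN : ∀ᵐ x ∂μ, ‖(g x : ℂ)‖ ≤ N) (φ : E3 → ℂ) :
    eLpNorm (fun x => (g x : ℂ) * φ x) 2 μ ≤ N * eLpNorm φ 2 μ := by
  refine eLpNorm_le_nnreal_smul_eLpNorm_of_ae_le_mul (hN.mono fun x hx => ?_) 2
  rw [← NNReal.coe_le_coe, NNReal.coe_mul, coe_nnnorm, coe_nnnorm, norm_mul]
  exact mul_le_mul_of_nonneg_right hx (norm_nonneg _)

/-- The operator `h ↦ ⟨x⟩^s R_k (1_D h)` from `L²(D)` to `L²(ℝ³)`. -/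
lemma exists_resolvent_clm (hDm : MeasurableSet D) (hD : Bornology.IsBounded D) (s t : ℝ)
    {C : ℝ≥0} (hC : ∀ φ : E3 → ℂ, MemL2w t φ → wnorm s (Rk k φ) ≤ C * wnorm t φ) :
    ∃ R : Lp ℂ 2 (volume.restrict D) →L[ℂ] Lp ℂ 2 (volume : Measure E3),
      ∀ h, R h =ᵐ[volume] weighted s (Rk k (D.indicator h)) := by
  obtain ⟨c, hc⟩ := exists_eLpNorm_weighted_le t hDm hD
  have hw : ∀ f : E3 → ℂ, wnorm t (D.indicator f) ≤ c * eLpNorm f 2 (volume.restrict D) :=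
    fun f => by
      rw [wnorm, weighted_indicator, eLpNorm_indicator_eq_eLpNorm_restrict hDm]
      exact hc f
  have hmeas : ∀ f : E3 → ℂ, MemLp f 2 (volume.restrict D) →
      AEStronglyMeasurable (D.indicator f) volume :=
    fun f hf => (aestronglyMeasurable_indicator_iff hDm).2 hf.1
  obtain ⟨R, -, hR, -⟩ := exists_clm_of_bound (volume.restrict D) (volume : Measure E3)
    (fun h => weighted s (Rk k (D.indicator h))) (C * c)
    (fun f hf => aestronglyMeasurable_weighted s (aestronglyMeasurable_Rk k (hmeas f hf)))
    (fun f g hfg => by simp only [Rk_congr k (indicator_congr_ae hDm hfg)]; rfl)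
    (fun f g hf hg => by rw [Rk_indicator_add k hDm hD hf hg, weighted_add])
    (fun c f _ => by rw [Rk_indicator_smul, weighted_smul])
    (fun f hf => by
      have hmem : MemL2w t (D.indicator f) :=
        ⟨aestronglyMeasurable_weighted t (hmeas f hf),
          (hw f).trans_lt (ENNReal.mul_lt_top ENNReal.coe_lt_top hf.2)⟩
      refine (hC _ hmem).trans ?_
      rw [ENNReal.coe_mul, mul_assoc]
      gcongr
      exact hw f)
  exact ⟨R, hR⟩

/-- The operator `w ↦ V ⟨x⟩^s w` from `L²(ℝ³)` to `L²(D)`. -/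
lemma exists_potential_clm (hDm : MeasurableSet D) (hD : Bornology.IsBounded D) (s : ℝ)
    (hV : MemLp V ∞ volume) :
    ∃ T : Lp ℂ 2 (volume : Measure E3) →L[ℂ] Lp ℂ 2 (volume.restrict D),
      ∀ w, T w =ᵐ[volume.restrict D] fun y => (V y : ℂ) * weighted s w y := by
  obtain ⟨c, hc⟩ := exists_eLpNorm_weighted_le s hDm hD
  obtain ⟨N, hN⟩ := exists_ae_bound hV
  obtain ⟨T, -, hT, -⟩ := exists_clm_of_bound (volume : Measure E3) (volume.restrict D)
    (fun w y => (V y : ℂ) * weighted s w y) (N * c)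
    (fun f hf => aestronglyMeasurable_ofReal_mul hV.1.restrict
      (aestronglyMeasurable_weighted s hf.1.restrict))
    (fun f g hfg => (weighted_congr s (ae_restrict_of_ae hfg)).mono fun y hy => by
      simp only [hy])
    (fun f g _ _ => by
      refine Eventually.of_forall fun y => ?_
      simp only [weighted_add, Pi.add_apply, mul_add])
    (fun a f _ => by
      refine Eventually.of_forall fun y => ?_
      simp only [weighted_smul, Pi.smul_apply, smul_eq_mul]
      ring)
    (fun f _ => by
      refine (eLpNorm_ofReal_mul_le (ae_restrict_of_ae hN) _).trans ?_
      rw [ENNReal.coe_mul, mul_assoc]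
      gcongr
      exact (hc f).trans (by gcongr; exact Measure.restrict_le_self))
  exact ⟨T, hT⟩

/-- If g - T R g = x, applying R gives (1 - R T)(R g) = R x. This determines R g, and then g = x + T
(R g). Only the space on which the Neumann series runs has to be complete. -/
lemma exists_inverse_one_sub_comp {E F : Type*} [NormedAddCommGroup E] [NormedSpace ℂ E]
    [NormedAddCommGroup F] [NormedSpace ℂ F] [CompleteSpace F]
    (R : E →L[ℂ] F) (T : F →L[ℂ] E) (h : ‖R ∘L T‖ < 1) :
    ∃ G : E →L[ℂ] E, ∀ x g, g - T (R g) = x ↔ g = G x := by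
  let U := Units.oneSub (R ∘L T) h
  have hU : (U : F →L[ℂ] F) = 1 - R ∘L T := Units.val_oneSub _ h
  have hU1 : ∀ y, ((U⁻¹ : (F →L[ℂ] F)ˣ) : F →L[ℂ] F) (y - R (T y)) = y := fun y => by
    have := congrArg (fun A : F →L[ℂ] F => A y) U.inv_mul
    simpa [hU] using this
  have hU2 : ∀ y, ((U⁻¹ : (F →L[ℂ] F)ˣ) : F →L[ℂ] F) y -
      R (T (((U⁻¹ : (F →L[ℂ] F)ˣ) : F →L[ℂ] F) y)) = y := fun y => by
    have := congrArg (fun A : F →L[ℂ] F => A y) U.mul_inv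
    simpa [hU] using this
  refine ⟨1 + T ∘L (((U⁻¹ : (F →L[ℂ] F)ˣ) : F →L[ℂ] F) ∘L R), fun x g => ⟨?_, ?_⟩⟩
  · rintro rfl
    have : R (g - T (R g)) = R g - R (T (R g)) := map_sub _ _ _
    simp [-map_sub, this, hU1]
  · rintro rfl
    set y := ((U⁻¹ : (F →L[ℂ] F)ˣ) : F →L[ℂ] F) (R x) with hy
    have hyx : y - R (T y) = R x := hU2 (R x)
    have : (1 + T ∘L (((U⁻¹ : (F →L[ℂ] F)ˣ) : F →L[ℂ] F) ∘L R)) x = x + T y := by simp [hy]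
    rw [this, map_add R, ← hyx, sub_add_cancel, add_sub_cancel_right]

/-- The inverse of `I - V R_k` as a bounded operator on `L²(D)`. -/
lemma exists_solution_clm (hDm : MeasurableSet D) (hD : Bornology.IsBounded D)
    (hV : MemLp V ∞ volume) (hVD : CompactlySupportedIn V D) {ε : ℝ}
    (hk : kStar ε V < ENNReal.ofReal k) :
    ∃ G : Lp ℂ 2 (volume.restrict D) →L[ℂ] Lp ℂ 2 (volume.restrict D),
      ∀ h (hh : MemLp h 2 (volume.restrict D)) g,
        IsSol D k V h g ↔ g =ᵐ[volume.restrict D] G (hh.toLp h) := by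
  obtain ⟨C, hC⟩ := agmon_of_kStar_lt hk
  obtain ⟨c, hc1, hc⟩ := exists_lt_one_of_kStar_lt hk
  set s := -1 / 2 - ε
  obtain ⟨R, hR⟩ := exists_resolvent_clm hDm hD s _ hC
  obtain ⟨T, hT⟩ := exists_potential_clm hDm hD (-s) hV
  -- Substituting φ = ⟨x⟩^{-s} w turns the contraction bound for R_k V on the weighted space into
  -- one for R T on L²(ℝ³). The cutoff to D inside R is harmless because V vanishes almost
  -- everywhere off D.
  have hRT : ‖R ∘L T‖ < 1 := by
    refine lt_of_le_of_lt (ContinuousLinearMap.opNorm_le_bound _ c.2 fun w => ?_)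
      (NNReal.coe_lt_one.2 hc1)
    have hsw : weighted s (weighted (-s) w) = w := by
      rw [weighted_weighted, add_neg_cancel, weighted_zero]
    have hmem : MemL2w s (weighted (-s) w) := by
      rw [MemL2w, hsw]
      exact Lp.memLp w
    have hb := hc _ hmem
    rw [wnorm, wnorm, hsw] at hb
    have hind : D.indicator (T w) =ᵐ[volume] fun y => (V y : ℂ) * weighted (-s) w y := by
      refine (indicator_congr_ae hDm (hT w)).trans ?_
      filter_upwards [hVD.ae_eq_zero] with y hy
      by_cases hyD : y ∈ D <;> simp [hyD, hy]
    have he : R (T w) =ᵐ[volume] weighted s (Rk k fun y => (V y : ℂ) * weighted (-s) w y) := by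
      rw [← Rk_congr k hind]
      exact hR _
    rw [← eLpNorm_congr_ae he] at hb
    rw [ContinuousLinearMap.comp_apply, Lp.norm_def, Lp.norm_def]
    have := ENNReal.toReal_mono (ENNReal.mul_ne_top ENNReal.coe_ne_top (Lp.memLp w).2.ne) hb
    rwa [ENNReal.toReal_mul, ENNReal.coe_toReal] at this
  have hTR : ∀ g, T (R g) =ᵐ[volume.restrict D] fun y => (V y : ℂ) * Rk k (D.indicator g) y :=
    fun g => by
      filter_upwards [hT (R g), ae_restrict_of_ae (s := D) (weighted_congr (-s) (hR g))]
        with y h1 h2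
      rw [h1, h2, weighted_weighted, neg_add_cancel, weighted_zero]
  obtain ⟨G, hG⟩ := exists_inverse_one_sub_comp R T hRT
  refine ⟨G, fun h hh g => ?_⟩
  have key : ∀ hg : MemLp g 2 (volume.restrict D),
      (∀ᵐ y ∂(volume.restrict D), g y - (V y : ℂ) * Rk k (D.indicator g) y = h y) ↔
        g =ᵐ[volume.restrict D] G (hh.toLp h) := fun hg => by
    have hTg := hTR (hg.toLp g)
    rw [Rk_congr k (indicator_congr_ae hDm hg.coeFn_toLp)] at hTg
    have e1 : hg.toLp g = G (hh.toLp h) ↔ g =ᵐ[volume.restrict D] G (hh.toLp h) := by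
      rw [Lp.ext_iff]
      exact ⟨fun H => hg.coeFn_toLp.symm.trans H, fun H => hg.coeFn_toLp.trans H⟩
    rw [← e1, ← hG, Lp.ext_iff]
    have e2 : (hg.toLp g - T (R (hg.toLp g)) : Lp ℂ 2 (volume.restrict D)) =ᵐ[volume.restrict D]
        fun y => g y - (V y : ℂ) * Rk k (D.indicator g) y := by
      filter_upwards [Lp.coeFn_sub (hg.toLp g) (T (R (hg.toLp g))), hTg, hg.coeFn_toLp]
        with y h1 h2 h3
      rw [h1, Pi.sub_apply, h2, h3]
    exact ⟨fun H => e2.trans (EventuallyEq.trans H hh.coeFn_toLp.symm),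
      fun H => e2.symm.trans (H.trans hh.coeFn_toLp)⟩
  constructor
  · rintro ⟨hg, H⟩
    exact (key hg).1 H
  · intro H
    have hg : MemLp g 2 (volume.restrict D) := (memLp_congr_ae H).2 (Lp.memLp _)
    exact ⟨hg, (key hg).2 H⟩

lemma hasBoundedInverse_of_clm
    {G : Lp ℂ 2 (volume.restrict D) →L[ℂ] Lp ℂ 2 (volume.restrict D)}
    (hG : ∀ h (hh : MemLp h 2 (volume.restrict D)) g,
        IsSol D k V h g ↔ g =ᵐ[volume.restrict D] G (hh.toLp h)) :
    HasBoundedInverse D k V := by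
  refine ⟨‖G‖₊, fun h hh => ⟨⟨_, (hG h hh _).2 ae_eq_rfl⟩, fun g g' hg hg' =>
    ((hG h hh g).1 hg).trans ((hG h hh g').1 hg').symm, fun g hg => ?_⟩⟩
  rw [eLpNorm_congr_ae ((hG h hh g).1 hg), ← eLpNorm_congr_ae hh.coeFn_toLp, ← Lp.enorm_def,
    ← Lp.enorm_def]
  exact G.le_opENorm _

/-- Equality holds everywhere, not just almost everywhere: the solution predicate sees the
right-hand side only up to null sets, so both sides choose from the same predicate. -/
lemma invIVR_congr {h h' : E3 → ℂ} (H : h =ᵐ[volume.restrict D] h') :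
    invIVR D k V h = invIVR D k V h' := by
  have : IsSol D k V h = IsSol D k V h' := by
    ext g
    exact and_congr_right fun _ => ⟨fun h1 => EventuallyEq.trans h1 H,
      fun h1 => EventuallyEq.trans h1 H.symm⟩
  unfold invIVR
  generalize IsSol D k V h = p at this ⊢
  subst this
  rfl

end Resolvent

/-! ### The white noise isometry and measurable versions -/

section WhiteNoise

variable {Ω : Type*} [MeasurableSpace Ω] {P : Measure Ω} {D : Set E3}
  {B : (E3 → ℝ) → Ω → ℝ}

lemma lintegral_enorm_sq_eq_ofReal {X : Type*} [MeasurableSpace X] {μ : Measure X} {f : X → ℝ}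
    (hf : MemLp f 2 μ) : ∫⁻ x, ‖f x‖ₑ ^ 2 ∂μ = ENNReal.ofReal (∫ x, f x ^ 2 ∂μ) := by
  rw [ofReal_integral_eq_lintegral_ofReal hf.integrable_sq
    (Eventually.of_forall fun x => sq_nonneg _)]
  congr 1 with x
  rw [← ofReal_norm, ← ENNReal.ofReal_pow (norm_nonneg _), Real.norm_eq_abs, sq_abs]

lemma integral_sub_sq {X : Type*} [MeasurableSpace X] {μ : Measure X} {f g : X → ℝ}
    (hf : MemLp f 2 μ) (hg : MemLp g 2 μ) : ∫ x, (f x - g x) ^ 2 ∂μ =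
      ∫ x, f x * f x ∂μ - 2 * ∫ x, f x * g x ∂μ + ∫ x, g x * g x ∂μ := by
  have hff : Integrable (fun x => f x * f x) μ := hf.integrable_mul hf
  have hfg : Integrable (fun x => 2 * (f x * g x)) μ := (hf.integrable_mul hg).const_mul 2
  have hgg : Integrable (fun x => g x * g x) μ := hg.integrable_mul hg
  have hs : Integrable (fun x => f x * f x - 2 * (f x * g x)) μ := hff.sub hfg
  rw [← integral_const_mul, ← integral_sub hff hfg, ← integral_add hs hgg]
  congr 1 with x
  ring

namespace IsWhiteNoise

lemma memLp (hB : IsWhiteNoise P D B) {φ : E3 → ℝ} (hφ : MemLp φ 2 (volume.restrict D)) :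
    MemLp (B φ) 2 P := by
  have h := hB.gaussian φ hφ
  have h2 : MemLp id 2 (P.map (B φ)) := by
    rw [h.map_eq]
    exact memLp_id_gaussianReal' 2 (by simp)
  exact (memLp_map_measure_iff h2.1 h.aemeasurable).1 h2

/-- Both squares are expanded and matched term by term through the covariance, so almost sure
linearity of `B` is never needed. -/
lemma lintegral_sub_sq (hB : IsWhiteNoise P D B) {φ ψ : E3 → ℝ}
    (hφ : MemLp φ 2 (volume.restrict D)) (hψ : MemLp ψ 2 (volume.restrict D)) :
    ∫⁻ ω, ‖B φ ω - B ψ ω‖ₑ ^ 2 ∂P = ∫⁻ x in D, ‖φ x - ψ x‖ₑ ^ 2 := by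
  have e1 := lintegral_enorm_sq_eq_ofReal ((hB.memLp hφ).sub (hB.memLp hψ))
  have e2 := lintegral_enorm_sq_eq_ofReal (hφ.sub hψ)
  simp only [Pi.sub_apply] at e1 e2
  rw [e1, e2]
  congr 1
  rw [integral_sub_sq (hB.memLp hφ) (hB.memLp hψ), integral_sub_sq hφ hψ, hB.covariance φ φ hφ hφ,
    hB.covariance φ ψ hφ hψ, hB.covariance ψ ψ hψ hψ]

lemma lintegral_sq (hB : IsWhiteNoise P D B) {φ : E3 → ℝ}
    (hφ : MemLp φ 2 (volume.restrict D)) :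
    ∫⁻ ω, ‖B φ ω‖ₑ ^ 2 ∂P = ∫⁻ x in D, ‖φ x‖ₑ ^ 2 := by
  rw [lintegral_enorm_sq_eq_ofReal (hB.memLp hφ), lintegral_enorm_sq_eq_ofReal hφ]
  simp only [sq, hB.covariance φ φ hφ hφ]

end IsWhiteNoise

lemma enorm_re_im_sq (a b : ℝ) :
    ‖(a : ℂ) + Complex.I * (b : ℂ)‖ₑ ^ 2 = ‖a‖ₑ ^ 2 + ‖b‖ₑ ^ 2 := by
  simp only [← ofReal_norm]
  rw [← ENNReal.ofReal_pow (norm_nonneg _), ← ENNReal.ofReal_pow (norm_nonneg _),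
    ← ENNReal.ofReal_pow (norm_nonneg _), ← ENNReal.ofReal_add (by positivity) (by positivity),
    mul_comm, ← Complex.normSq_eq_norm_sq, Complex.normSq_add_mul_I, Real.norm_eq_abs,
    Real.norm_eq_abs, sq_abs, sq_abs]

lemma enorm_sq_eq_re_im (z : ℂ) : ‖z‖ₑ ^ 2 = ‖z.re‖ₑ ^ 2 + ‖z.im‖ₑ ^ 2 := by
  rw [← enorm_re_im_sq, mul_comm, Complex.re_add_im]

namespace IsWhiteNoise

lemma memLp_pairing (hB : IsWhiteNoise P D B) {φ : E3 → ℂ}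
    (hφ : MemLp φ 2 (volume.restrict D)) : MemLp (pairing B φ) 2 P := by
  have h1 : MemLp (fun ω => (B (fun y => (φ y).re) ω : ℂ)) 2 P := (hB.memLp hφ.re).ofReal
  have h2 : MemLp (fun ω => (B (fun y => (φ y).im) ω : ℂ)) 2 P := (hB.memLp hφ.im).ofReal
  exact h1.add (h2.const_mul Complex.I)

lemma lintegral_pairing_sub_sq (hB : IsWhiteNoise P D B) {φ ψ : E3 → ℂ}
    (hφ : MemLp φ 2 (volume.restrict D)) (hψ : MemLp ψ 2 (volume.restrict D)) :
    ∫⁻ ω, ‖pairing B φ ω - pairing B ψ ω‖ₑ ^ 2 ∂P = ∫⁻ x in D, ‖φ x - ψ x‖ₑ ^ 2 := by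
  have e : ∀ ω, ‖pairing B φ ω - pairing B ψ ω‖ₑ ^ 2 =
      ‖B (fun y => (φ y).re) ω - B (fun y => (ψ y).re) ω‖ₑ ^ 2 +
        ‖B (fun y => (φ y).im) ω - B (fun y => (ψ y).im) ω‖ₑ ^ 2 := fun ω => by
    rw [← enorm_re_im_sq]
    congr 2
    simp only [pairing]
    push_cast
    ring
  have hr : AEStronglyMeasurable (fun ω => B (fun y => (φ y).re) ω - B (fun y => (ψ y).re) ω) P :=
    ((hB.memLp hφ.re).sub (hB.memLp hψ.re)).1
  have hr' : AEStronglyMeasurable (fun y => (φ y).re - (ψ y).re) (volume.restrict D) :=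
    (hφ.re.sub hψ.re).1
  simp only [e, enorm_sq_eq_re_im (_ - _), Complex.sub_re, Complex.sub_im]
  rw [lintegral_add_left' (hr.enorm.pow_const 2), lintegral_add_left' (hr'.enorm.pow_const 2)]
  exact congrArg₂ (· + ·) (hB.lintegral_sub_sq hφ.re hψ.re) (hB.lintegral_sub_sq hφ.im hψ.im)

lemma lintegral_pairing_sq (hB : IsWhiteNoise P D B) {φ : E3 → ℂ}
    (hφ : MemLp φ 2 (volume.restrict D)) :
    ∫⁻ ω, ‖pairing B φ ω‖ₑ ^ 2 ∂P = ∫⁻ x in D, ‖φ x‖ₑ ^ 2 := by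
  have hr : AEStronglyMeasurable (fun ω => B (fun y => (φ y).re) ω) P := (hB.memLp hφ.re).1
  have hr' : AEStronglyMeasurable (fun y => (φ y).re) (volume.restrict D) := hφ.re.1
  simp only [pairing, enorm_re_im_sq, enorm_sq_eq_re_im (φ _)]
  rw [lintegral_add_left' (hr.enorm.pow_const 2), lintegral_add_left' (hr'.enorm.pow_const 2)]
  exact congrArg₂ (· + ·) (hB.lintegral_sq hφ.re) (hB.lintegral_sq hφ.im)

open scoped Classical in
/-- A family of square integrable functions that depends measurably on a parameter gives a random
field with a jointly measurable version. -/
lemma exists_measurableVersion (hB : IsWhiteNoise P D B) {T : Type*} [MeasurableSpace T]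
    (Θ Θ' : T → E3 → ℂ) (hΘ' : Measurable fun p : T × E3 => Θ' p.1 p.2)
    (hΘ : ∀ t, Θ t =ᵐ[volume.restrict D] Θ' t) (hm : ∀ t, MemLp (Θ t) 2 (volume.restrict D)) :
    ∃ W, IsMeasurableVersion P (fun t => pairing B (Θ t)) W := by
  have : Fact ((2 : ℝ≥0∞) ≠ ∞) := ⟨by simp⟩
  let ψ : ℕ → Lp ℂ 2 (volume.restrict D) := TopologicalSpace.denseSeq _
  -- The tolerance 4⁻ⁿ for squared distances makes the mean square errors summable.
  let r : ℕ → ℝ≥0∞ := fun n => ((2⁻¹ : ℝ≥0∞) ^ n) ^ 2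
  have hex : ∀ n t, ∃ j, ∫⁻ y in D, ‖Θ' t y - ψ j y‖ₑ ^ 2 < r n := fun n t => by
    obtain ⟨_, ⟨j, rfl⟩, hj⟩ := EMetric.mem_closure_iff.1
      (TopologicalSpace.denseRange_denseSeq (Lp ℂ 2 (volume.restrict D)) ((hm t).toLp _))
      ((2⁻¹ : ℝ≥0∞) ^ n) (ENNReal.pow_pos (by simp) n)
    refine ⟨j, ?_⟩
    rw [Lp.edist_def, eLpNorm_congr_ae (((hm t).coeFn_toLp.trans (hΘ t)).sub ae_eq_rfl)] at hj
    have := ENNReal.pow_lt_pow_left two_ne_zero hj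
    rwa [eLpNorm_two_sq] at this
  have hmeasj : ∀ n j, MeasurableSet {t | ∫⁻ y in D, ‖Θ' t y - ψ j y‖ₑ ^ 2 < r n} := fun n j => by
    refine measurableSet_lt (Measurable.lintegral_prod_right' (ν := volume.restrict D)
      (f := fun p : T × E3 => ‖Θ' p.1 p.2 - ψ j p.2‖ₑ ^ 2) ?_) measurable_const
    exact ((hΘ'.sub ((Lp.stronglyMeasurable (ψ j)).measurable.comp measurable_snd)).enorm).pow_const
      2
  -- Taking the least admissible index makes the selection measurable in the parameter.
  let i : ℕ → T → ℕ := fun n t => Nat.find (hex n t)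
  have hi : ∀ n, Measurable (i n) := fun n => measurable_find (hex n) (hmeasj n)
  have hψ : ∀ j, MemLp (pairing B (ψ j)) 2 P := fun j => hB.memLp_pairing (Lp.memLp (ψ j))
  -- Each pairing is only almost everywhere measurable, so a measurable representative is fixed for
  -- each of the countably many dense elements.
  let Y : ℕ → Ω → ℂ := fun j => (hψ j).1.mk
  have hY : Measurable fun p : ℕ × Ω => Y p.1 p.2 :=
    measurable_from_prod_countable_right fun j => (hψ j).1.stronglyMeasurable_mk.measurable
  refine ⟨fun t ω => limUnder atTop fun n => Y (i n t) ω, ?_, fun t => ?_⟩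
  · refine (StronglyMeasurable.limUnder (f := fun n (p : T × Ω) => Y (i n p.1) p.2)
      fun n => ?_).measurable
    exact (hY.comp (((hi n).comp measurable_fst).prodMk measurable_snd)).stronglyMeasurable
  · have hae : ∀ n, Y (i n t) =ᵐ[P] pairing B (ψ (i n t)) :=
      fun n => (hψ (i n t)).1.ae_eq_mk.symm
    have hbd : ∀ n, ∫⁻ ω, ‖Y (i n t) ω - pairing B (Θ t) ω‖ₑ ^ 2 ∂P ≤ (2⁻¹ : ℝ≥0∞) ^ n := fun n => by
      calc _ = ∫⁻ ω, ‖pairing B (Θ t) ω - pairing B (ψ (i n t)) ω‖ₑ ^ 2 ∂P := by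
            refine lintegral_congr_ae ((hae n).mono fun ω h => ?_)
            simp only [h]
            rw [← enorm_neg, neg_sub]
        _ = ∫⁻ y in D, ‖Θ' t y - ψ (i n t) y‖ₑ ^ 2 := by
            rw [hB.lintegral_pairing_sub_sq (hm t) (Lp.memLp _)]
            exact lintegral_congr_ae ((hΘ t).mono fun y h => by simp only [h])
        _ ≤ r n := (Nat.find_spec (hex n t)).le
        _ ≤ _ := pow_le_of_le_one (by simp) (pow_le_one₀ (by simp) (by simp)) two_ne_zero
    have hmeas : ∀ n, AEMeasurable (fun ω => ‖Y (i n t) ω - pairing B (Θ t) ω‖ₑ ^ 2) P := fun n =>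
      (((hψ _).1.stronglyMeasurable_mk.aestronglyMeasurable.sub
        (hB.memLp_pairing (hm t)).1).enorm).pow_const 2
    -- Finite expectation of the summed squared errors makes the sum finite almost surely, so the
    -- whole sequence converges without passing to a subsequence.
    have hsum : ∫⁻ ω, ∑' n, ‖Y (i n t) ω - pairing B (Θ t) ω‖ₑ ^ 2 ∂P ≠ ∞ := by
      rw [lintegral_tsum hmeas]
      refine ((ENNReal.tsum_le_tsum hbd).trans_lt ?_).ne
      rw [ENNReal.tsum_geometric]
      simp
    filter_upwards [ae_lt_top' (AEMeasurable.tsum hmeas) hsum] with ω hω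
    refine Tendsto.limUnder_eq ?_
    have h0 := ENNReal.tendsto_atTop_zero_of_tsum_ne_top hω.ne
    have h1 : Tendsto (fun n => ‖Y (i n t) ω - pairing B (Θ t) ω‖ ^ 2) atTop (𝓝 0) := by
      have := (ENNReal.tendsto_toReal ENNReal.zero_ne_top).comp h0
      simpa [Function.comp_def, ENNReal.toReal_pow] using this
    have h2 := h1.sqrt
    simp only [Real.sqrt_sq (norm_nonneg _), Real.sqrt_zero] at h2
    exact tendsto_iff_norm_sub_tendsto_zero.2 h2

end IsWhiteNoise

end WhiteNoise

/-! ### The two random fields of the far-field formula -/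

section Fields

variable {Ω : Type*} [MeasurableSpace Ω] {P : Measure Ω} {D : Set E3}
  {B : (E3 → ℝ) → Ω → ℝ} {σ : E3 → ℝ} {k : ℝ}

lemma exists_ae_bound_of_sq (hσ : MemLp (fun x => σ x ^ 2) ∞ volume) :
    ∃ N : ℝ≥0, ∀ᵐ x, ‖(σ x : ℂ)‖ ≤ N := by
  obtain ⟨N, hN⟩ := exists_ae_bound hσ
  refine ⟨NNReal.sqrt N, hN.mono fun x hx => ?_⟩
  rw [Complex.norm_real] at hx ⊢
  rw [Real.coe_sqrt]
  refine Real.le_sqrt_of_sq_le ?_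
  rwa [norm_pow] at hx

lemma memLp_ofReal_mul {N : ℝ≥0} (hσm : AEStronglyMeasurable σ volume)
    (hN : ∀ᵐ x, ‖(σ x : ℂ)‖ ≤ N) {φ : E3 → ℂ} (hφ : MemLp φ 2 (volume.restrict D)) :
    MemLp (fun y => (σ y : ℂ) * φ y) 2 (volume.restrict D) :=
  ⟨aestronglyMeasurable_ofReal_mul hσm.restrict hφ.1,
    (eLpNorm_ofReal_mul_le (ae_restrict_of_ae hN) φ).trans_lt
      (ENNReal.mul_lt_top ENNReal.coe_lt_top hφ.2)⟩

lemma measurable_planeWave (k : ℝ) : Measurable fun p : S2 × E3 => planeWave k p.1 p.2 := by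
  refine Continuous.measurable ?_
  unfold planeWave
  fun_prop

lemma norm_planeWave (k : ℝ) (xhat : S2) (y : E3) : ‖planeWave k xhat y‖ = 1 := by
  rw [planeWave, neg_mul, ← mul_neg, ← Complex.ofReal_neg, mul_comm,
    Complex.norm_exp_ofReal_mul_I]

lemma memLp_planeWave (hD : Bornology.IsBounded D) (k : ℝ) (xhat : S2) :
    MemLp (planeWave k xhat) 2 (volume.restrict D) := by
  have : IsFiniteMeasure (volume.restrict D) := ⟨by simpa using hD.measure_lt_top⟩
  exact MemLp.of_bound ((measurable_planeWave k).comp measurable_prodMk_left).aestronglyMeasurable 1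
    (Eventually.of_forall fun y => (norm_planeWave k xhat y).le)

lemma exists_version_RkNoise (hD : Bornology.IsBounded D) (hB : IsWhiteNoise P D B)
    (hσm : AEStronglyMeasurable σ volume) (hσ : MemLp (fun x => σ x ^ 2) ∞ volume) :
    ∃ W, IsMeasurableVersion P (RkNoise B σ k) W := by
  obtain ⟨N, hN⟩ := exists_ae_bound_of_sq hσ
  refine hB.exists_measurableVersion _ (fun x y => ((hσm.mk σ y : ℝ) : ℂ) * Phi k x y) ?_ (fun x => ?_)
    fun x => memLp_ofReal_mul hσm hN (memLp_Phi k hD x)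
  · exact (Complex.measurable_ofReal.comp
      (hσm.stronglyMeasurable_mk.measurable.comp measurable_snd)).mul (measurable_Phi k)
  · exact (ae_restrict_of_ae hσm.ae_eq_mk).mono fun y hy => by simp only [hy]

lemma memLp_planeWave_mul {N : ℝ≥0} (hD : Bornology.IsBounded D)
    (hσm : AEStronglyMeasurable σ volume) (hN : ∀ᵐ x, ‖(σ x : ℂ)‖ ≤ N) (k : ℝ) (xhat : S2) :
    MemLp (fun y => planeWave k xhat y * (σ y : ℂ)) 2 (volume.restrict D) := by
  simpa only [mul_comm] using memLp_ofReal_mul hσm hN (memLp_planeWave hD k xhat)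

lemma exists_version_sphereNoise (hD : Bornology.IsBounded D) (hB : IsWhiteNoise P D B)
    (hσm : AEStronglyMeasurable σ volume) (hσ : MemLp (fun x => σ x ^ 2) ∞ volume) :
    ∃ Z, IsMeasurableVersion P (sphereNoise B σ k) Z := by
  obtain ⟨N, hN⟩ := exists_ae_bound_of_sq hσ
  refine hB.exists_measurableVersion _ (fun x y => planeWave k x y * ((hσm.mk σ y : ℝ) : ℂ)) ?_
    (fun x => ?_) fun x => memLp_planeWave_mul hD hσm hN k x
  · exact (measurable_planeWave k).mul (Complex.measurable_ofReal.comp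
      (hσm.stronglyMeasurable_mk.measurable.comp measurable_snd))
  · exact (ae_restrict_of_ae hσm.ae_eq_mk).mono fun y hy => by simp only [hy]

/-- The random field `R_k(σ B)` has a uniformly bounded second moment. -/
lemma exists_lintegral_RkNoise_le (hD : Bornology.IsBounded D) (hB : IsWhiteNoise P D B)
    (hσm : AEStronglyMeasurable σ volume) (hσ : MemLp (fun x => σ x ^ 2) ∞ volume) :
    ∃ M : ℝ≥0, ∀ x, ∫⁻ ω, ‖RkNoise B σ k x ω‖ₑ ^ 2 ∂P ≤ M := by
  obtain ⟨N, hN⟩ := exists_ae_bound_of_sq hσ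
  obtain ⟨M, hM⟩ := exists_lintegral_Phi_le k hD
  refine ⟨N ^ 2 * M, fun x => ?_⟩
  refine (hB.lintegral_pairing_sq (memLp_ofReal_mul hσm hN (memLp_Phi k hD x))).le.trans ?_
  rw [← eLpNorm_two_sq]
  refine (pow_le_pow_left' (eLpNorm_ofReal_mul_le (ae_restrict_of_ae hN) _) 2).trans ?_
  rw [mul_pow, eLpNorm_two_sq]
  push_cast
  gcongr
  exact hM x

/-- The random field `⟨B, e^{-i k x̂·(·)} σ⟩` has a uniformly bounded second moment. -/
lemma exists_lintegral_sphereNoise_le (hD : Bornology.IsBounded D) (hB : IsWhiteNoise P D B)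
    (hσm : AEStronglyMeasurable σ volume) (hσ : MemLp (fun x => σ x ^ 2) ∞ volume) :
    ∃ M : ℝ≥0, ∀ x, ∫⁻ ω, ‖sphereNoise B σ k x ω‖ₑ ^ 2 ∂P ≤ M := by
  obtain ⟨N, hN⟩ := exists_ae_bound_of_sq hσ
  have hfin : (volume.restrict D) Set.univ < ∞ := by simpa using hD.measure_lt_top
  refine ⟨N ^ 2 * ((volume.restrict D) Set.univ).toNNReal, fun x => ?_⟩
  refine (hB.lintegral_pairing_sq (memLp_planeWave_mul hD hσm hN k x)).le.trans ?_
  rw [ENNReal.coe_mul, ENNReal.coe_toNNReal hfin.ne, ENNReal.coe_pow, ← lintegral_const]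
  refine lintegral_mono_ae ((ae_restrict_of_ae hN).mono fun y hy => pow_le_pow_left' ?_ 2)
  rw [enorm_mul, ← ofReal_norm (planeWave k x y), norm_planeWave, ENNReal.ofReal_one, one_mul,
    ← ofReal_norm]
  exact ENNReal.ofReal_le_of_le_toReal (by simpa using hy)

end Fields

/-! ### The far-field functional of the solution -/

section Functional

variable {D : Set E3} {k : ℝ} {V : E3 → ℝ}

lemma isFiniteMeasure_restrict (hD : Bornology.IsBounded D) :
    IsFiniteMeasure (volume.restrict D) := ⟨by simpa using hD.measure_lt_top⟩

lemma HasBoundedInverse.isSol_invIVR (hI : HasBoundedInverse D k V) {h : E3 → ℂ}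
    (hh : MemLp h 2 (volume.restrict D)) : IsSol D k V h (invIVR D k V h) := by
  obtain ⟨C, hC⟩ := hI
  have H := (hC h hh).1
  rw [invIVR, dif_pos H]
  exact H.choose_spec

/-- The plane wave has modulus 1, so the L¹ norm of the solution bounds the integral. Cauchy–Schwarz
on the finite measure space D costs |D|^{1/2}, the constant `b`, and the bounded inverse costs `C`.
-/
lemma HasBoundedInverse.exists_integral_planeWave_le (hI : HasBoundedInverse D k V)
    (hD : Bornology.IsBounded D) :
    ∃ K : ℝ≥0, ∀ h, MemLp h 2 (volume.restrict D) → ∀ xhat,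
      ‖∫ y in D, planeWave k xhat y * invIVR D k V h y‖ₑ ^ 2 ≤ K * ∫⁻ y in D, ‖h y‖ₑ ^ 2 := by
  have hfin := isFiniteMeasure_restrict hD
  obtain ⟨C, hC⟩ := id hI
  obtain ⟨b, hb⟩ : ∃ b : ℝ≥0, (b : ℝ≥0∞) =
      (volume.restrict D) Set.univ ^ (1 / (1 : ℝ≥0∞).toReal - 1 / (2 : ℝ≥0∞).toReal) :=
    ⟨_, ENNReal.coe_toNNReal
      (ENNReal.rpow_lt_top_of_nonneg (by norm_num) (measure_lt_top _ _).ne).ne⟩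
  refine ⟨(C * b) ^ 2, fun h hh xhat => ?_⟩
  have hsol := hI.isSol_invIVR hh
  have h1 : ‖∫ y in D, planeWave k xhat y * invIVR D k V h y‖ₑ ≤
      (C * b) * eLpNorm h 2 (volume.restrict D) := by
    calc _ ≤ ∫⁻ y in D, ‖planeWave k xhat y * invIVR D k V h y‖ₑ :=
          enorm_integral_le_lintegral_enorm _
      _ = eLpNorm (invIVR D k V h) 1 (volume.restrict D) := by
          rw [eLpNorm_one_eq_lintegral_enorm]
          congr 1 with y
          rw [enorm_mul, ← ofReal_norm, norm_planeWave, ENNReal.ofReal_one, one_mul]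
      _ ≤ eLpNorm (invIVR D k V h) 2 (volume.restrict D) * b := by
          rw [hb]
          exact eLpNorm_le_eLpNorm_mul_rpow_measure_univ (by norm_num) hsol.1.1
      _ ≤ (C * eLpNorm h 2 (volume.restrict D)) * b := by
          gcongr
          exact (hC h hh).2.2 _ hsol
      _ = _ := by ring
  calc _ ≤ ((C * b) * eLpNorm h 2 (volume.restrict D)) ^ 2 := pow_le_pow_left' h1 2
    _ = _ := by
      rw [mul_pow, eLpNorm_two_sq]
      push_cast
      rfl

lemma continuous_planeWave_left (k : ℝ) (y : E3) : Continuous fun xhat => planeWave k xhat y := by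
  unfold planeWave
  fun_prop

lemma aestronglyMeasurable_planeWave {μ : Measure E3} (k : ℝ) (xhat : S2) :
    AEStronglyMeasurable (planeWave k xhat) μ :=
  ((measurable_planeWave k).comp measurable_prodMk_left).aestronglyMeasurable

lemma continuous_integral_planeWave (hD : Bornology.IsBounded D) {g : E3 → ℂ}
    (hg : MemLp g 2 (volume.restrict D)) :
    Continuous fun xhat => ∫ y in D, planeWave k xhat y * g y := by
  have hfin := isFiniteMeasure_restrict hD
  refine continuous_of_dominated (bound := fun y => ‖g y‖)
    (fun xhat => (aestronglyMeasurable_planeWave k xhat).mul hg.1)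
    (fun xhat => Eventually.of_forall fun y => ?_) (hg.integrable (by norm_num)).norm
    (Eventually.of_forall fun y => (continuous_planeWave_left k y).mul continuous_const)
  rw [norm_mul, norm_planeWave, one_mul]

/-- The integral is the inner product of the conjugated plane wave with G h. Moving G to the other
side, ψ is the conjugate of the adjoint applied to that conjugated wave; it does not depend on h. -/
lemma integral_planeWave_mul_clm (hD : Bornology.IsBounded D)
    (G : Lp ℂ 2 (volume.restrict D) →L[ℂ] Lp ℂ 2 (volume.restrict D)) (xhat : S2) :
    ∃ ψ : E3 → ℂ, Measurable ψ ∧ ∀ h (hh : MemLp h 2 (volume.restrict D)),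
      ∫ y in D, planeWave k xhat y * G (hh.toLp h) y = ∫ y in D, ψ y * h y := by
  have hp : MemLp (fun y => star (planeWave k xhat y)) 2 (volume.restrict D) :=
    (memLp_planeWave hD k xhat).star
  obtain ⟨q, hq⟩ : ∃ q, q = ContinuousLinearMap.adjoint G (hp.toLp _) := ⟨_, rfl⟩
  refine ⟨fun y => star (q y),
    continuous_star.measurable.comp (Lp.stronglyMeasurable _).measurable, fun h hh => ?_⟩
  have e := ContinuousLinearMap.adjoint_inner_left G (hh.toLp h) (hp.toLp _)
  rw [← hq, L2.inner_def, L2.inner_def] at e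
  calc _ = ∫ y in D, inner ℂ (hp.toLp _ y) (G (hh.toLp h) y) := by
        refine integral_congr_ae (hp.coeFn_toLp.mono fun y hy => ?_)
        dsimp only
        rw [hy, RCLike.inner_apply, RCLike.star_def, Complex.conj_conj, mul_comm]
    _ = _ := e.symm
    _ = _ := by
        refine integral_congr_ae (hh.coeFn_toLp.mono fun y hy => ?_)
        dsimp only
        rw [hy, RCLike.inner_apply, RCLike.star_def, mul_comm]

/-- A Carathéodory argument: the integral is continuous in the direction for fixed ω and, by the
adjoint formula, measurable in ω for fixed direction. -/
lemma stronglyMeasurable_integral_planeWave {Ω : Type*} [MeasurableSpace Ω]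
    (hD : Bornology.IsBounded D)
    {G : Lp ℂ 2 (volume.restrict D) →L[ℂ] Lp ℂ 2 (volume.restrict D)}
    (hG : ∀ h (hh : MemLp h 2 (volume.restrict D)) g,
        IsSol D k V h g ↔ g =ᵐ[volume.restrict D] G (hh.toLp h))
    {h : Ω → E3 → ℂ} (hm : Measurable fun p : Ω × E3 => h p.1 p.2)
    (hh : ∀ ω, MemLp (h ω) 2 (volume.restrict D)) :
    StronglyMeasurable fun p : S2 × Ω =>
      ∫ y in D, planeWave k p.1 y * invIVR D k V (h p.2) y := by
  have hI := hasBoundedInverse_of_clm hG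
  refine stronglyMeasurable_uncurry_of_continuous_of_stronglyMeasurable
    (u := fun xhat ω => ∫ y in D, planeWave k xhat y * invIVR D k V (h ω) y)
    (fun ω => continuous_integral_planeWave hD (hI.isSol_invIVR (hh ω)).1) fun xhat => ?_
  obtain ⟨ψ, hψm, hψ⟩ := integral_planeWave_mul_clm (k := k) hD G xhat
  have e : (fun ω => ∫ y in D, planeWave k xhat y * invIVR D k V (h ω) y) =
      fun ω => ∫ y in D, ψ y * h ω y := by
    ext ω
    rw [← hψ (h ω) (hh ω)]
    exact integral_congr_ae (((hG _ (hh ω) _).1 (hI.isSol_invIVR (hh ω))).mono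
      fun y hy => by simp only [hy])
  rw [e]
  exact StronglyMeasurable.integral_prod_right' (f := fun p : Ω × E3 => ψ p.2 * h p.1 p.2)
    ((hψm.comp measurable_snd).mul hm).stronglyMeasurable

end Functional

/-! ### Bounds on the source, uniform in the incident direction -/

section Source

variable {D : Set E3} {k α : ℝ} {V f : E3 → ℝ}

lemma norm_incident (k : ℝ) (d : S2) (y : E3) : ‖incident k d y‖ = 1 := by
  rw [incident, mul_comm, Complex.norm_exp_ofReal_mul_I]

lemma measurable_incident (k : ℝ) (d : S2) : Measurable (incident k d) := by
  refine Continuous.measurable ?_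
  unfold incident
  fun_prop

lemma exists_lintegral_source_le (hD : Bornology.IsBounded D) (hV : MemLp V ∞ volume)
    (hf : MemLp f ∞ volume) (hα : α = 0 ∨ α = 1) :
    ∃ a b : ℝ≥0, ∀ (d : S2) (W : E3 → ℂ),
      ∫⁻ y in D, ‖source k V f α d W y‖ₑ ^ 2 ≤ a + b * ∫⁻ y in D, ‖W y‖ₑ ^ 2 := by
  have hfin := isFiniteMeasure_restrict hD
  obtain ⟨N, hN⟩ := exists_ae_bound hV
  obtain ⟨N', hN'⟩ := exists_ae_bound hf
  obtain ⟨m, hm⟩ : ∃ m : ℝ≥0, (m : ℝ≥0∞) = (volume.restrict D) Set.univ :=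
    ⟨_, ENNReal.coe_toNNReal (measure_lt_top _ _).ne⟩
  refine ⟨4 * (N ^ 2 + N' ^ 2) * m, 2 * N ^ 2, fun d W => ?_⟩
  have hpt : ∀ᵐ y ∂(volume.restrict D), ‖source k V f α d W y‖ₑ ^ 2 ≤
      ((4 * (N ^ 2 + N' ^ 2) : ℝ≥0) : ℝ≥0∞) + ((2 * N ^ 2 : ℝ≥0) : ℝ≥0∞) * ‖W y‖ₑ ^ 2 := by
    filter_upwards [ae_restrict_of_ae hN, ae_restrict_of_ae hN'] with y hy hy'
    have e1 : ‖(V y : ℂ)‖ₑ ≤ N := by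
      rw [enorm_le_coe]
      exact_mod_cast hy
    have e2 : ‖(f y : ℂ)‖ₑ ≤ N' := by
      rw [enorm_le_coe]
      exact_mod_cast hy'
    have e3 : ‖(α : ℂ) * (V y : ℂ) * incident k d y‖ₑ ≤ N := by
      rw [enorm_mul, ← ofReal_norm (incident k d y), norm_incident, ENNReal.ofReal_one, mul_one]
      rcases hα with rfl | rfl
      · simp
      · simpa using e1
    calc _ ≤ 2 * (‖(α : ℂ) * (V y : ℂ) * incident k d y - (f y : ℂ)‖ₑ ^ 2 +
            ‖(V y : ℂ) * W y‖ₑ ^ 2) := enorm_sub_sq_le _ _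
      _ ≤ 2 * (2 * (‖(α : ℂ) * (V y : ℂ) * incident k d y‖ₑ ^ 2 + ‖(f y : ℂ)‖ₑ ^ 2) +
            ‖(V y : ℂ) * W y‖ₑ ^ 2) := by
          gcongr
          exact enorm_sub_sq_le _ _
      _ ≤ 2 * (2 * ((N : ℝ≥0∞) ^ 2 + (N' : ℝ≥0∞) ^ 2) + ((N : ℝ≥0∞) * ‖W y‖ₑ) ^ 2) := by
          rw [enorm_mul (V y : ℂ)]
          gcongr
      _ = _ := by
          push_cast
          ring
  refine (lintegral_mono_ae hpt).trans ?_
  rw [lintegral_add_left measurable_const, lintegral_const_mul' _ _ ENNReal.coe_ne_top,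
    lintegral_const, ← hm, ENNReal.coe_mul _ m]

lemma aestronglyMeasurable_source {μ : Measure E3} (hV : AEStronglyMeasurable V μ)
    (hf : AEStronglyMeasurable f μ) (d : S2) {W : E3 → ℂ} (hW : AEStronglyMeasurable W μ) :
    AEStronglyMeasurable (source k V f α d W) μ := by
  have hVc := Complex.continuous_ofReal.comp_aestronglyMeasurable hV
  have hfc := Complex.continuous_ofReal.comp_aestronglyMeasurable hf
  exact (((hVc.const_mul (α : ℂ)).mul (measurable_incident k d).aestronglyMeasurable).sub hfc).sub
    (hVc.mul hW)

lemma memLp_source (hD : Bornology.IsBounded D) (hV : MemLp V ∞ volume)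
    (hf : MemLp f ∞ volume) (hα : α = 0 ∨ α = 1) (d : S2) {W : E3 → ℂ}
    (hW : MemLp W 2 (volume.restrict D)) :
    MemLp (source k V f α d W) 2 (volume.restrict D) := by
  obtain ⟨a, b, hab⟩ := exists_lintegral_source_le (k := k) hD hV hf hα
  refine memLp_two_iff_lintegral.2
    ⟨aestronglyMeasurable_source hV.1.restrict hf.1.restrict d hW.1, (hab d W).trans_lt ?_⟩
  exact ENNReal.add_lt_top.2 ⟨ENNReal.coe_lt_top,
    ENNReal.mul_lt_top ENNReal.coe_lt_top (memLp_two_iff_lintegral.1 hW).2⟩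

lemma source_congr {μ : Measure E3} {V' f' : E3 → ℝ} {W W' : E3 → ℂ} (hV : V =ᵐ[μ] V')
    (hf : f =ᵐ[μ] f') (hW : W =ᵐ[μ] W') (d : S2) :
    source k V f α d W =ᵐ[μ] source k V' f' α d W' := by
  filter_upwards [hV, hf, hW] with y h1 h2 h3
  simp only [source, h1, h2, h3]

end Source

/-! ### Tonelli and Fubini for measurable versions -/

section Versions

variable {T Ω : Type*} [MeasurableSpace T] [MeasurableSpace Ω] {P : Measure Ω}
  {X Y : T → Ω → ℂ}

lemma IsMeasurableVersion.lintegral_lintegral_lt_top [SFinite P] (hY : IsMeasurableVersion P X Y)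
    (τ : Measure T) [IsFiniteMeasure τ] {M : ℝ≥0} (hM : ∀ t, ∫⁻ ω, ‖X t ω‖ₑ ^ 2 ∂P ≤ M) :
    ∫⁻ ω, ∫⁻ t, ‖Y t ω‖ₑ ^ 2 ∂τ ∂P < ∞ := by
  have hm : Measurable fun p : T × Ω => ‖Y p.1 p.2‖ₑ ^ 2 := hY.1.enorm.pow_const 2
  have hs : AEMeasurable (Function.uncurry fun ω t => ‖Y t ω‖ₑ ^ 2) (P.prod τ) :=
    (hm.comp measurable_swap).aemeasurable
  rw [lintegral_lintegral_swap hs]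
  calc ∫⁻ t, ∫⁻ ω, ‖Y t ω‖ₑ ^ 2 ∂P ∂τ ≤ ∫⁻ _, M ∂τ := lintegral_mono fun t => by
        refine (lintegral_congr_ae ((hY.2 t).mono fun ω h => ?_)).trans_le (hM t)
        simp only [h]
    _ < ∞ := by
        rw [lintegral_const]
        exact ENNReal.mul_lt_top ENNReal.coe_lt_top (measure_lt_top _ _)

lemma IsMeasurableVersion.measurable_lintegral (hY : IsMeasurableVersion P X Y)
    (τ : Measure T) [SFinite τ] : Measurable fun ω => ∫⁻ t, ‖Y t ω‖ₑ ^ 2 ∂τ :=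
  Measurable.lintegral_prod_left' (f := fun p : T × Ω => ‖Y p.1 p.2‖ₑ ^ 2)
    (hY.1.enorm.pow_const 2)

lemma IsMeasurableVersion.ae_lintegral_lt_top [SFinite P] (hY : IsMeasurableVersion P X Y)
    (τ : Measure T) [IsFiniteMeasure τ] {M : ℝ≥0} (hM : ∀ t, ∫⁻ ω, ‖X t ω‖ₑ ^ 2 ∂P ≤ M) :
    ∀ᵐ ω ∂P, ∫⁻ t, ‖Y t ω‖ₑ ^ 2 ∂τ < ∞ :=
  ae_lt_top (hY.measurable_lintegral τ) (hY.lintegral_lintegral_lt_top τ hM).ne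

/-- Two versions agree almost surely at each parameter, with a null set depending on the parameter.
Fubini exchanges the quantifiers, and joint measurability makes this legitimate. -/
lemma IsMeasurableVersion.ae_ae_eq [SFinite P] {Y' : T → Ω → ℂ} (hY : IsMeasurableVersion P X Y)
    (hY' : IsMeasurableVersion P X Y') (τ : Measure T) [SFinite τ] :
    ∀ᵐ ω ∂P, (fun t => Y t ω) =ᵐ[τ] fun t => Y' t ω := by
  refine (Measure.ae_ae_comm (p := fun t ω => Y t ω = Y' t ω) ?_).1
    (Eventually.of_forall fun t => (hY.2 t).trans (hY'.2 t).symm)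
  exact measurableSet_eq_fun hY.1 hY'.1

lemma IsMeasurableVersion.memLp_section (hY : IsMeasurableVersion P X Y) (τ : Measure T) {ω : Ω}
    (hω : ∫⁻ t, ‖Y t ω‖ₑ ^ 2 ∂τ < ∞) : MemLp (fun t => Y t ω) 2 τ :=
  memLp_two_iff_lintegral.2 ⟨(hY.1.comp measurable_prodMk_right).aestronglyMeasurable, hω⟩

end Versions

/-! ### Measurability and integrability of the far-field pattern -/

section FarField

variable {Ω : Type*} {D : Set E3} {k α : ℝ} {V f : E3 → ℝ}
  {W : E3 → Ω → ℂ} {Z : S2 → Ω → ℂ}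

lemma enorm_farField_sq_le {K : ℝ≥0}
    (hK : ∀ h, MemLp h 2 (volume.restrict D) → ∀ xhat,
      ‖∫ y in D, planeWave k xhat y * invIVR D k V h y‖ₑ ^ 2 ≤ K * ∫⁻ y in D, ‖h y‖ₑ ^ 2)
    {ω : Ω} {d : S2} (hs : MemLp (source k V f α d fun x => W x ω) 2 (volume.restrict D))
    (xhat : S2) :
    ‖farField D k V f α W Z xhat d ω‖ₑ ^ 2 ≤
      2 * (K * (∫⁻ y in D, ‖source k V f α d (fun x => W x ω) y‖ₑ ^ 2) + ‖Z xhat ω‖ₑ ^ 2) := by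
  have h1 : ‖(1 / (4 * Real.pi) : ℂ)‖ₑ ≤ 1 := by
    rw [← ofReal_norm, ← ENNReal.ofReal_one]
    refine ENNReal.ofReal_le_ofReal ?_
    rw [norm_div, norm_mul, Complex.norm_real, Real.norm_of_nonneg Real.pi_pos.le, norm_one]
    refine (div_le_one (by simp [Real.pi_pos])).2 ?_
    simp only [Complex.norm_ofNat]
    linarith [Real.pi_gt_three]
  rw [farField, enorm_mul, mul_pow]
  calc _ ≤ 1 * _ := mul_le_mul_left (pow_le_one₀ (by simp) h1) _
    _ ≤ _ := by
      rw [one_mul]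
      refine (enorm_sub_sq_le _ _).trans ?_
      gcongr
      exact hK _ hs xhat

lemma continuous_integral_invIVR (hD : Bornology.IsBounded D) (hI : HasBoundedInverse D k V)
    {h : E3 → ℂ} (hh : MemLp h 2 (volume.restrict D)) :
    Continuous fun xhat => ∫ y in D, planeWave k xhat y * invIVR D k V h y :=
  continuous_integral_planeWave hD (hI.isSol_invIVR hh).1

lemma memLp_farField (hD : Bornology.IsBounded D) (hI : HasBoundedInverse D k V) {ω : Ω} {d : S2}
    (hs : MemLp (source k V f α d fun x => W x ω) 2 (volume.restrict D))
    (hZ : MemLp (fun xhat => Z xhat ω) 2 surf) :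
    MemLp (fun xhat : S2 => farField D k V f α W Z xhat d ω) 2 surf := by
  obtain ⟨K, hK⟩ := hI.exists_integral_planeWave_le hD
  refine memLp_two_iff_lintegral.2 ⟨?_, ?_⟩
  · exact ((continuous_integral_invIVR hD hI hs).aestronglyMeasurable.sub hZ.1).const_mul _
  · refine (lintegral_mono fun xhat => enorm_farField_sq_le hK hs xhat).trans_lt ?_
    rw [lintegral_const_mul' _ _ (by simp), lintegral_add_left measurable_const, lintegral_const]
    refine ENNReal.mul_lt_top (by simp) (ENNReal.add_lt_top.2 ⟨?_, (memLp_two_iff_lintegral.1 hZ).2⟩)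
    exact ENNReal.mul_lt_top (ENNReal.mul_lt_top ENNReal.coe_lt_top
      (memLp_two_iff_lintegral.1 hs).2) (measure_lt_top _ _)

variable [MeasurableSpace Ω] {P : Measure Ω}

open scoped Classical in
lemma aestronglyMeasurable_farField (hD : Bornology.IsBounded D)
    {G : Lp ℂ 2 (volume.restrict D) →L[ℂ] Lp ℂ 2 (volume.restrict D)}
    (hG : ∀ h (hh : MemLp h 2 (volume.restrict D)) g,
        IsSol D k V h g ↔ g =ᵐ[volume.restrict D] G (hh.toLp h))
    (hV : MemLp V ∞ volume) (hf : MemLp f ∞ volume) (hα : α = 0 ∨ α = 1)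
    (hW : Measurable fun p : E3 × Ω => W p.1 p.2) (hZ : Measurable fun p : S2 × Ω => Z p.1 p.2)
    (hfin : ∀ᵐ ω ∂P, ∫⁻ x in D, ‖W x ω‖ₑ ^ 2 < ∞) (d : S2) :
    AEStronglyMeasurable (fun p : S2 × Ω => farField D k V f α W Z p.1 d p.2) (surf.prod P) := by
  have hmW : Measurable fun ω => ∫⁻ x in D, ‖W x ω‖ₑ ^ 2 :=
    Measurable.lintegral_prod_left' (f := fun p : E3 × Ω => ‖W p.1 p.2‖ₑ ^ 2)
      (hW.enorm.pow_const 2)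
  -- Realizations that are not square integrable are replaced by zero, so that the source lies in
  -- L²(D) for every ω. This alters the far field only on a null set of ω.
  let W₀ : Ω → E3 → ℂ := fun ω x => if ∫⁻ x in D, ‖W x ω‖ₑ ^ 2 < ∞ then W x ω else 0
  have hW₀ : Measurable fun p : Ω × E3 => W₀ p.1 p.2 :=
    Measurable.ite (measurableSet_lt (hmW.comp measurable_fst) measurable_const)
      (hW.comp measurable_swap) measurable_const
  have hW₀L : ∀ ω, MemLp (W₀ ω) 2 (volume.restrict D) := fun ω => by
    by_cases h : ∫⁻ x in D, ‖W x ω‖ₑ ^ 2 < ∞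
    · simp only [W₀, if_pos h]
      exact memLp_two_iff_lintegral.2 ⟨(hW.comp measurable_prodMk_right).aestronglyMeasurable, h⟩
    · simp only [W₀, if_neg h]
      exact MemLp.zero
  let h₀ : Ω → E3 → ℂ := fun ω => source k (hV.1.mk V) (hf.1.mk f) α d (W₀ ω)
  have hh₀ : ∀ ω, h₀ ω =ᵐ[volume.restrict D] source k V f α d (W₀ ω) := fun ω =>
    source_congr (ae_restrict_of_ae hV.1.ae_eq_mk.symm) (ae_restrict_of_ae hf.1.ae_eq_mk.symm)
      ae_eq_rfl d
  have hh₀m : Measurable fun p : Ω × E3 => h₀ p.1 p.2 := by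
    have hVm : Measurable fun p : Ω × E3 => ((hV.1.mk V p.2 : ℝ) : ℂ) :=
      Complex.measurable_ofReal.comp
        (hV.1.stronglyMeasurable_mk.measurable.comp measurable_snd)
    have hfm : Measurable fun p : Ω × E3 => ((hf.1.mk f p.2 : ℝ) : ℂ) :=
      Complex.measurable_ofReal.comp
        (hf.1.stronglyMeasurable_mk.measurable.comp measurable_snd)
    exact (((hVm.const_mul (α : ℂ)).mul ((measurable_incident k d).comp measurable_snd)).sub
      hfm).sub (hVm.mul hW₀)
  have hsm := stronglyMeasurable_integral_planeWave hD hG hh₀m fun ω =>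
    (memLp_congr_ae (hh₀ ω)).2 (memLp_source hD hV hf hα d (hW₀L ω))
  refine ⟨_, (hsm.sub hZ.stronglyMeasurable).const_mul (1 / (4 * Real.pi) : ℂ), ?_⟩
  filter_upwards [Measure.quasiMeasurePreserving_snd.ae hfin] with p hp
  have e : W₀ p.2 = fun x => W x p.2 := by
    ext x
    simp only [W₀, if_pos hp]
  have e2 := invIVR_congr (k := k) (V := V) (hh₀ p.2)
  rw [e] at e2
  simp only [farField, Pi.sub_apply, e2]

lemma lintegral_lintegral_farField_lt_top [IsProbabilityMeasure P] (hD : Bornology.IsBounded D)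
    (hI : HasBoundedInverse D k V)
    (hV : MemLp V ∞ volume) (hf : MemLp f ∞ volume) (hα : α = 0 ∨ α = 1)
    (hWm : Measurable fun p : E3 × Ω => W p.1 p.2)
    (hfin : ∀ᵐ ω ∂P, ∫⁻ x in D, ‖W x ω‖ₑ ^ 2 < ∞)
    (hW : ∫⁻ ω, (∫⁻ x in D, ‖W x ω‖ₑ ^ 2) ∂P < ∞)
    (hZ : ∫⁻ ω, ∫⁻ xhat, ‖Z xhat ω‖ₑ ^ 2 ∂surf ∂P < ∞) (d : S2) :
    ∫⁻ ω, ∫⁻ xhat, ‖farField D k V f α W Z xhat d ω‖ₑ ^ 2 ∂surf ∂P < ∞ := by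
  obtain ⟨K, hK⟩ := hI.exists_integral_planeWave_le hD
  obtain ⟨a, b, hab⟩ := exists_lintegral_source_le (k := k) hD hV hf hα
  have hmW : Measurable fun ω => ∫⁻ x in D, ‖W x ω‖ₑ ^ 2 :=
    Measurable.lintegral_prod_left' (f := fun p : E3 × Ω => ‖W p.1 p.2‖ₑ ^ 2)
      (hWm.enorm.pow_const 2)
  have hpt : ∀ᵐ ω ∂P, ∫⁻ xhat, ‖farField D k V f α W Z xhat d ω‖ₑ ^ 2 ∂surf ≤
      2 * (K * (a + b * ∫⁻ y in D, ‖W y ω‖ₑ ^ 2) * surf Set.univ +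
        ∫⁻ xhat, ‖Z xhat ω‖ₑ ^ 2 ∂surf) := by
    filter_upwards [hfin] with ω hω
    have hs : MemLp (source k V f α d fun x => W x ω) 2 (volume.restrict D) :=
      memLp_source hD hV hf hα d (memLp_two_iff_lintegral.2
        ⟨(hWm.comp measurable_prodMk_right).aestronglyMeasurable, hω⟩)
    refine (lintegral_mono fun xhat => enorm_farField_sq_le hK hs xhat).trans ?_
    rw [lintegral_const_mul' _ _ (by simp), lintegral_add_left measurable_const, lintegral_const]
    gcongr
    exact hab d _
  refine (lintegral_mono_ae hpt).trans_lt ?_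
  rw [lintegral_const_mul' _ _ (by simp), lintegral_add_left (by fun_prop),
    lintegral_mul_const' _ _ (measure_ne_top _ _), lintegral_const_mul' _ _ ENNReal.coe_ne_top,
    lintegral_add_left measurable_const, lintegral_const_mul' _ _ ENNReal.coe_ne_top,
    lintegral_const, measure_univ, mul_one]
  have h1 : (b : ℝ≥0∞) * ∫⁻ ω, (∫⁻ x in D, ‖W x ω‖ₑ ^ 2) ∂P < ∞ :=
    ENNReal.mul_lt_top ENNReal.coe_lt_top hW
  exact ENNReal.mul_lt_top (by simp) (ENNReal.add_lt_top.2 ⟨ENNReal.mul_lt_top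
    (ENNReal.mul_lt_top ENNReal.coe_lt_top (ENNReal.add_lt_top.2 ⟨ENNReal.coe_lt_top, h1⟩))
    (measure_lt_top _ _), hZ⟩)

end FarField

end RandomSchrodinger

open RandomSchrodinger

theorem mainTheorem5 {Ω : Type*} [MeasurableSpace Ω] (P : Measure Ω) [IsProbabilityMeasure P]
    (D : Set E3) (hDo : IsOpen D) (hDc : IsConnected D) (hDb : Bornology.IsBounded D)
    (hD0 : (0 : E3) ∈ D)
    (σ V f : E3 → ℝ)
    (hσm : AEStronglyMeasurable σ volume) (hσ : MemLp (fun x => σ x ^ 2) ∞ volume)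
    (hV : MemLp V ∞ volume) (hf : MemLp f ∞ volume)
    (hσD : CompactlySupportedIn σ D) (hVD : CompactlySupportedIn V D)
    (hfD : CompactlySupportedIn f D)
    (B : (E3 → ℝ) → Ω → ℝ) (hB : IsWhiteNoise P D B)
    (α : ℝ) (hα : α = 0 ∨ α = 1)
    (ε : ℝ) (hε : 0 < ε) (k : ℝ) (hk : kStar ε V < ENNReal.ofReal k) :
    -- the operator `I - V R_k` is invertible on `L²(D)`
    HasBoundedInverse D k V ∧
    -- the random fields in the formula for the far-field pattern have measurable versions
    (∃ (W : E3 → Ω → ℂ) (Z : S2 → Ω → ℂ),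
      IsMeasurableVersion P (RkNoise B σ k) W ∧ IsMeasurableVersion P (sphereNoise B σ k) Z) ∧
    -- the far-field pattern does not depend on the versions, up to modification
    (∀ (W W' : E3 → Ω → ℂ) (Z Z' : S2 → Ω → ℂ),
      IsMeasurableVersion P (RkNoise B σ k) W → IsMeasurableVersion P (sphereNoise B σ k) Z →
      IsMeasurableVersion P (RkNoise B σ k) W' → IsMeasurableVersion P (sphereNoise B σ k) Z' →
      ∀ xhat d : S2, ∀ᵐ ω ∂P,
        farField D k V f α W Z xhat d ω = farField D k V f α W' Z' xhat d ω) ∧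
    -- whichever versions are used, it is square integrable
    ∀ (W : E3 → Ω → ℂ) (Z : S2 → Ω → ℂ),
      IsMeasurableVersion P (RkNoise B σ k) W → IsMeasurableVersion P (sphereNoise B σ k) Z →
      (∀ d : S2,
        AEStronglyMeasurable (fun p : S2 × Ω => farField D k V f α W Z p.1 d p.2) (surf.prod P) ∧
        ∫⁻ ω, ∫⁻ xhat, ‖farField D k V f α W Z xhat d ω‖ₑ ^ 2 ∂surf ∂P < ∞) ∧
      ∃ Ω₀ : Set Ω, P Ω₀ = 0 ∧ ∀ ω ∉ Ω₀, ∀ d : S2,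
        IsSol D k V (source k V f α d fun x => W x ω)
          (invIVR D k V (source k V f α d fun x => W x ω)) ∧
        MemLp (fun xhat : S2 => farField D k V f α W Z xhat d ω) 2 surf := by
  have hDm := hDo.measurableSet
  have hfinD := isFiniteMeasure_restrict hDb
  obtain ⟨G, hG⟩ := exists_solution_clm hDm hDb hV hVD hk
  have hI := hasBoundedInverse_of_clm hG
  refine ⟨hI, ?_, ?_, fun W Z hW hZ => ?_⟩
  · obtain ⟨W, hW⟩ := exists_version_RkNoise (k := k) hDb hB hσm hσ
    obtain ⟨Z, hZ⟩ := exists_version_sphereNoise (k := k) hDb hB hσm hσ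
    exact ⟨W, Z, hW, hZ⟩
  · intro W W' Z Z' hW hZ hW' hZ' xhat d
    filter_upwards [hW.ae_ae_eq hW' (volume.restrict D), hZ.2 xhat, hZ'.2 xhat] with ω h1 h2 h3
    rw [farField, farField, invIVR_congr (source_congr (ae_eq_refl V) (ae_eq_refl f) h1 d), h2, h3]
  · obtain ⟨M, hM⟩ := exists_lintegral_RkNoise_le (k := k) hDb hB hσm hσ
    obtain ⟨M', hM'⟩ := exists_lintegral_sphereNoise_le (k := k) hDb hB hσm hσ
    have hWae := hW.ae_lintegral_lt_top (volume.restrict D) hM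
    have hZae := hZ.ae_lintegral_lt_top surf hM'
    refine ⟨fun d => ⟨aestronglyMeasurable_farField hDb hG hV hf hα hW.1 hZ.1 hWae d,
      lintegral_lintegral_farField_lt_top hDb hI hV hf hα hW.1 hWae
        (hW.lintegral_lintegral_lt_top _ hM) (hZ.lintegral_lintegral_lt_top _ hM') d⟩,
      -- The exceptional set involves only the two fields and not d, so one null set serves all
      -- incident directions.
      {ω | ¬ (∫⁻ x in D, ‖W x ω‖ₑ ^ 2 < ∞ ∧ ∫⁻ xhat, ‖Z xhat ω‖ₑ ^ 2 ∂surf < ∞)},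
      ae_iff.1 (hWae.and hZae), fun ω hω d => ?_⟩
    obtain ⟨h1, h2⟩ := not_not.1 hω
    have hs := memLp_source (k := k) hDb hV hf hα d (hW.memLp_section _ h1)
    exact ⟨hI.isSol_invIVR hs, memLp_farField hDb hI hs (hZ.memLp_section _ h2)⟩
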